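/- **Setting.** Let $L\ge 1$, let $d_0,\dots,d_L$ be natural numbers, $M^{(l)}\in\mathbb R^{d_l\times d_{l-1}}$ fixed reference matrices, $a_l,s_l,\rho_l>0$, and let $\sigma_l:\mathbb R^{d_l}\to\mathbb R^{d_l}$ be $\rho_l$-Lipschitz for the Euclidean norm ($1\le l\le L$). Let $$\mathcal A=\prod_{l=1}^L\Big\{A^{(l)}\in\mathbb R^{d_l\times d_{l-1}}:\ \|A^{(l)}\|_\sigma\le s_l,\ \|(A^{(l)}-M^{(l)})^\top\|_{2,1}\le a_l\Big\},$$ where $\|\cdot\|_\sigma$ is the spectral norm and $\|\cdot\|_{2,1}$ is the sum of the Euclidean norms of the columns. For $\mathbf A\in\mathcal A$ put $F_{\mathbf A}^{1\to 0}(x)=x$, $F_{\mathbf A}^{1\to l}(x)=\sigma_l\big(A^{(l)}F_{\mathbf A}^{1\to l-1}(x)\big)$ and $F_{\mathbf A}=F_{\mathbf A}^{1\to L}$. Let $\mathcal C$ be a set of latent classes with a discrete probability $\pi$, no class having probability $1$, and let $\mathcal D_c$ ($c\in\mathcal C$) be probability distributions on $\mathbb R^{d_0}$. Put $\bar{\mathcal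 D}_c=\sum_{z\ne c}\pi(z)\mathcal D_z\big/\sum_{z\ne c}\pi(z)$. A random input tuple $X=(x,x^+,x_1^-,\dots,x_k^-)$ is drawn by drawing $c\sim\pi$ and then independently $x,x^+\sim\mathcal D_c$ and $x_1^-,\dots,x_k^-\sim\bar{\mathcal D}_c$. Let $\mathcal S=(X_1,\dots,X_n)$, $n\ge1$, be i.i.d. input tuples. For a loss $\ell:\mathbb R^k\to[0,1]$, let $$\mathrm{L_{un}}(f)=\mathbb E\,\ell\big(\{f(x)^\top(f(x^+)-f(x_i^-))\}_{i=1}^k\big),\qquad \mathrm{\widehat L_{un}}(f)=\frac1n\sum_{j=1}^n\ell\big(\{f(x_j)^\top(f(x_j^+)-f(x_{ji}^-))\}_{i=1}^k\big).$$ **Theorem.** There are absolute constants $C>0$ and $p\in\mathbb N$ such that in every such setting the following holds. Let $\ell:\mathbb R^k\to[0,1]$ satisfy $|\ell(v)-\ell(w)|\le\eta\|v-w\|_\infty$ for all $v,w$, with $\eta\ge1$, let $b_0,\dots,b_L\ge1$ and $\delta\in(0,1)$. Then with probability at least $1-\delta$ over $\mathcal S$: if $\|\tilde x\|_2\le 3b_0$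 for all inputs $\tilde x$ occurring in the tuples of $\mathcal S$, then for all $\mathbf A\in\mathcal A$ simultaneously $$\mathrm{L_{un}}(F_{\mathbf A})-\mathrm{\widehat L_{un}}(F_{\mathbf A})\ \le\ C\,\frac{\eta b_L^2\widehat{\mathcal R}_{\mathcal A}}{\sqrt n}\,(1+\log W)\,\log^p\!\Big(\big(\eta b_L^2\widehat{\mathcal R}_{\mathcal A}\,n+7\big)\,n\,(k+2)\Big)+\frac{\mathcal I_{\mathbf A,\mathbf B}}{n}+3\sqrt{\frac{\log(2/\delta)}{2n}},$$ where $W=\max_{1\le l\le L}d_l$ (with $\log 0:=0$), $$\widehat{\mathcal R}_{\mathcal A}^{2/3}=\sum_{l=1}^L(a_lb_{l-1}\hat\rho_l)^{2/3},\qquad \hat\rho_l=\rho_l\sup_{l\le u\le L}b_u^{-1}\prod_{m=l+1}^u s_m\rho_m,$$ and $\mathcal I_{\mathbf A,\mathbf B}$ is the number of indices $j$ such that $\|F_{\mathbf A}^{1\to l}(\tilde x)\|_2>b_l$ for some $1\le l\le L$ and some input $\tilde x$ of the tuple $X_j$. -/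

import Mathlib

open MeasureTheory

namespace ContrastiveNet

noncomputable section

/-- `ℝ^m` with the Euclidean norm. -/
abbrev Vec (m : ℕ) : Type := EuclideanSpace ℝ (Fin m)

/-- The linear map `z ↦ A z` between Euclidean spaces. -/
def mulVecLin {m p : ℕ} (A : Matrix (Fin m) (Fin p) ℝ) : Vec p →L[ℝ] Vec m :=
  LinearMap.toContinuousLinearMap (Matrix.toEuclideanLin A)

/-- The spectral norm: the operator norm of `z ↦ A z` for Euclidean norms. -/
def specNorm {m p : ℕ} (A : Matrix (Fin m) (Fin p) ℝ) : ℝ :=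
  ‖mulVecLin A‖

/-- The `(2,1)` norm: the sum over the columns of their Euclidean norms. -/
def norm21 {m p : ℕ} (B : Matrix (Fin m) (Fin p) ℝ) : ℝ :=
  ∑ j, Real.sqrt (∑ i, B i j ^ 2)

/-- Weights of a network with layer widths `d 0, d 1, …`. Layers are counted from `0`, so that
`A l` maps `ℝ^(d l)` to `ℝ^(d (l+1))`. Only the layers `l < L` matter for a network of depth `L`. -/
abbrev Weights (d : ℕ → ℕ) : Type := (l : ℕ) → Matrix (Fin (d (l + 1))) (Fin (d l)) ℝ

/-- One activation function for each layer, acting on the output space of that layer. -/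
abbrev Activations (d : ℕ → ℕ) : Type := (l : ℕ) → Vec (d (l + 1)) → Vec (d (l + 1))

/-- The parameter space `∏ₗ {A : ‖A‖_σ ≤ sₗ, ‖(A - Mₗ)ᵀ‖_{2,1} ≤ aₗ}` (product over the `L`
layers). -/
def paramSpace (L : ℕ) {d : ℕ → ℕ} (M : Weights d) (a s : ℕ → ℝ) : Set (Weights d) :=
  {A | ∀ l < L, specNorm (A l) ≤ s l ∧ norm21 (A l - M l).transpose ≤ a l}

/-- The sub-network consisting of the first `l` layers. The whole network of depth `L` is
`subnet σ A L`. -/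
def subnet {d : ℕ → ℕ} (σ : Activations d) (A : Weights d) : (l : ℕ) → Vec (d 0) → Vec (d l)
  | 0 => fun x => x
  | l + 1 => fun x => σ l (mulVecLin (A l) (subnet σ A l x))

/-- An input tuple `(x, x⁺, (x₁⁻, …, x_k⁻))`. -/
abbrev InputTuple (d₀ k : ℕ) : Type := Vec d₀ × Vec d₀ × (Fin k → Vec d₀)

/-- The set of all the inputs of a tuple. -/
def inputs {d₀ k : ℕ} (X : InputTuple d₀ k) : Set (Vec d₀) :=
  {X.1, X.2.1} ∪ Set.range X.2.2

/-- The loss of a representation function `f` on a tuple: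
`ℓ ({f(x)ᵀ (f(x⁺) - f(xᵢ⁻))}ᵢ)`. -/
def tupleLoss {d₀ m k : ℕ} (ℓ : (Fin k → ℝ) → ℝ) (f : Vec d₀ → Vec m) (X : InputTuple d₀ k) : ℝ :=
  ℓ (fun i => inner ℝ (f X.1) (f X.2.1 - f (X.2.2 i)))

/-- The distribution of a data point given that its latent class is not `c`:
`(∑_{z ≠ c} π(z) D_z) / (∑_{z ≠ c} π(z))`. -/
def negDist {𝒞 : Type*} {d₀ : ℕ} (π : PMF 𝒞) (D : 𝒞 → Measure (Vec d₀)) (c : 𝒞) :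
    Measure (Vec d₀) :=
  (∑' z : {z : 𝒞 // z ≠ c}, π z)⁻¹ • Measure.sum (fun z : {z : 𝒞 // z ≠ c} => π z • D z)

/-- The law of an input tuple: draw `c ∼ π`, and given `c` draw independently
`x, x⁺ ∼ D_c` and `x₁⁻, …, x_k⁻ ∼ negDist π D c`. -/
def tupleLaw {𝒞 : Type*} {d₀ : ℕ} (k : ℕ) (π : PMF 𝒞) (D : 𝒞 → Measure (Vec d₀)) :
    Measure (InputTuple d₀ k) :=
  Measure.sum fun c =>
    π c • (D c).prod ((D c).prod (Measure.pi fun _ : Fin k => negDist π D c))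

/-- The law of a sample of `n` independent input tuples. -/
def sampleLaw {𝒞 : Type*} {d₀ : ℕ} (n k : ℕ) (π : PMF 𝒞) (D : 𝒞 → Measure (Vec d₀)) :
    Measure (Fin n → InputTuple d₀ k) :=
  Measure.pi fun _ => tupleLaw k π D

/-- The population unsupervised risk. -/
def popRisk {𝒞 : Type*} {d₀ m k : ℕ} (π : PMF 𝒞) (D : 𝒞 → Measure (Vec d₀))
    (ℓ : (Fin k → ℝ) → ℝ) (f : Vec d₀ → Vec m) : ℝ :=
  ∫ X, tupleLoss ℓ f X ∂(tupleLaw k π D)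

/-- The empirical unsupervised risk. -/
def empRisk {d₀ m n k : ℕ} (ℓ : (Fin k → ℝ) → ℝ) (f : Vec d₀ → Vec m)
    (S : Fin n → InputTuple d₀ k) : ℝ :=
  (1 / (n : ℝ)) * ∑ j, tupleLoss ℓ f (S j)

/-- The number of tuples in the sample with an input on which the activation after some layer
`l ∈ {1, …, L}` has norm above `b l`. -/
def numExceed {d : ℕ → ℕ} {n k : ℕ} (L : ℕ) (σ : Activations d) (A : Weights d) (b : ℕ → ℝ)
    (S : Fin n → InputTuple (d 0) k) : ℕ :=
  Set.ncard {j : Fin n | ∃ l ∈ Set.Icc 1 L, ∃ x ∈ inputs (S j), b l < ‖subnet σ A l x‖}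

/-- `ρ̂ₗ = ρₗ sup_{u ≥ l} b_u⁻¹ ∏_{m=l+1}^u s_m ρ_m`. Layers are counted from `0`, so the bound on
the output of layer `u` is `b (u + 1)`, and `u` runs over `l ≤ u < L`. -/
def rhoHat (L : ℕ) (ρ s b : ℕ → ℝ) (l : ℕ) : ℝ :=
  ρ l * ⨆ u : Set.Ico l L, (b (u + 1))⁻¹ * ∏ m ∈ Finset.Ioc l u, s m * ρ m

/-- `R̂ = (∑ₗ (aₗ b_{l-1} ρ̂ₗ)^{2/3})^{3/2}`. Layers are counted from `0`, so the bound on the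
input of layer `l` is `b l`. -/
def rHat (L : ℕ) (a ρ s b : ℕ → ℝ) : ℝ :=
  (∑ l ∈ Finset.range L, (a l * b l * rhoHat L ρ s b l) ^ (2 / 3 : ℝ)) ^ (3 / 2 : ℝ)

/-- The maximal width of the layers, `max_{1 ≤ l ≤ L} d l`. -/
def maxWidth (L : ℕ) (d : ℕ → ℕ) : ℕ :=
  (Finset.Icc 1 L).sup d

end

end ContrastiveNet

open ContrastiveNet

namespace ContrastiveNet

noncomputable section

/-! The loss is replaced by a `surrogate` with values in [0,1]: the maximum of the loss and a ramp
in the largest ratio between an activation norm and its bound b_l, with value 1 on tuples having an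
input longer than 3b_0. The surrogate dominates the loss. On a sample with bounded inputs it differs
from the loss only on the tuples counted by `numExceed`, so it is enough to control the uniform
deviation of the surrogate.

Networks can be approximated economically only while their activations stay bounded. The ramp makes
this harmless: at the first layer where a network exceeds 2b_l its approximant still follows it, so
both surrogates are close to 1 and later layers do not matter (`abs_surrogate_sub_le`).

A single matrix is covered by running a perceptron on each row. The (2,1) budget is shared among the
rows, so the width enters the entropy only logarithmically (`exists_matrix_cover`). Layers are then
covered one after the other, each at the outputs of the network already chosen. Distributing the
accuracies so as to minimise the total entropy produces the 2/3 powers and an entropy of order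
R̂²/ε² up to logarithms (`exists_network_cover`). For such an entropy every dyadic scale contributes
equally to the chaining sum, and about log n scales suffice (`cubeMean_iSup_radSum_le`).

Concentration uses exponential moments: a ghost sample symmetrises the deviation, and for a fixed
double sample the bounded differences inequality is applied to the random signs alone
(`measure_deviation_finite_le`). The Rademacher bound holds for every double sample, so no further
concentration in the data is needed. Suprema are taken over finite parts of a dense sequence of
parameters, and continuity in the weights recovers the whole class. -/

/-- The sign `±1` attached to a Boolean. -/
def sgn (b : Bool) : ℝ := if b then 1 else -1

lemma abs_sgn (b : Bool) : |sgn b| = 1 := by cases b <;> simp [sgn]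

/-! ### Averages and bounded differences on the sign cube -/

/-- The mean of a function on the discrete cube. -/
def cubeMean {n : ℕ} (f : (Fin n → Bool) → ℝ) : ℝ := (∑ τ, f τ) / 2 ^ n

lemma cubeMean_mono {n : ℕ} {f g : (Fin n → Bool) → ℝ} (h : ∀ τ, f τ ≤ g τ) :
    cubeMean f ≤ cubeMean g := by
  unfold cubeMean
  gcongr with τ
  exact h τ

lemma cubeMean_const {n : ℕ} (c : ℝ) : cubeMean (fun _ : Fin n → Bool => c) = c := by
  simp [cubeMean]

lemma cubeMean_add {n : ℕ} (f g : (Fin n → Bool) → ℝ) :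
    cubeMean (fun τ => f τ + g τ) = cubeMean f + cubeMean g := by
  simp [cubeMean, Finset.sum_add_distrib, add_div]

lemma cubeMean_mul {n : ℕ} (c : ℝ) (f : (Fin n → Bool) → ℝ) :
    cubeMean (fun τ => c * f τ) = c * cubeMean f := by
  simp [cubeMean, ← Finset.mul_sum, mul_div_assoc]

lemma cubeMean_sum {n : ℕ} {ι : Type*} (s : Finset ι) (f : ι → (Fin n → Bool) → ℝ) :
    cubeMean (fun τ => ∑ i ∈ s, f i τ) = ∑ i ∈ s, cubeMean (f i) := by
  simp only [cubeMean]
  rw [Finset.sum_comm, Finset.sum_div]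

lemma cubeMean_succ {n : ℕ} (f : (Fin (n + 1) → Bool) → ℝ) :
    cubeMean f = (cubeMean (fun τ : Fin n → Bool => f (Fin.cons true τ)) +
      cubeMean (fun τ : Fin n → Bool => f (Fin.cons false τ))) / 2 := by
  have h : ∑ τ, f τ = ∑ p : Bool × (Fin n → Bool), f (Fin.cons p.1 p.2) :=
    ((Fin.consEquiv (fun _ => Bool)).sum_comp f).symm
  simp only [cubeMean]
  rw [h, Fintype.sum_prod_type, Fintype.sum_bool, pow_succ]
  field_simp

/-- Two-point case of Hoeffding's lemma: after centring, the mean is a cosh, and cosh t ≤ exp(t²/2).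
-/
lemma exp_add_exp_le (x y c : ℝ) (h : |x - y| ≤ c) :
    (Real.exp x + Real.exp y) / 2 ≤ Real.exp ((x + y) / 2 + c ^ 2 / 8) := by
  have h1 : (Real.exp x + Real.exp y) / 2 = Real.exp ((x + y) / 2) * Real.cosh ((x - y) / 2) := by
    rw [Real.cosh_eq, mul_div_assoc', mul_add, ← Real.exp_add, ← Real.exp_add]
    ring_nf
  have h2 : ((x - y) / 2) ^ 2 / 2 ≤ c ^ 2 / 8 := by
    have := sq_le_sq' (abs_le.1 h).1 (abs_le.1 h).2
    linarith
  rw [h1, Real.exp_add]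
  gcongr
  exact (Real.cosh_le_exp_half_sq _).trans (Real.exp_le_exp.2 h2)

/-- The bounded differences inequality on the discrete cube. -/
lemma cubeMean_exp_le {n : ℕ} (f : (Fin n → Bool) → ℝ) (c : ℝ)
    (h : ∀ τ j b, |f (Function.update τ j b) - f τ| ≤ c) :
    cubeMean (fun τ => Real.exp (f τ)) ≤ Real.exp (cubeMean f + n * c ^ 2 / 8) := by
  induction n with
  | zero => simp [cubeMean]
  | succ n ih =>
    have hb : ∀ b, cubeMean (fun τ : Fin n → Bool => Real.exp (f (Fin.cons b τ))) ≤
        Real.exp (cubeMean (fun τ : Fin n → Bool => f (Fin.cons b τ)) + n * c ^ 2 / 8) := by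
      intro b
      refine ih _ fun τ j b' => ?_
      rw [Fin.cons_update]
      exact h _ _ _
    have hd : |cubeMean (fun τ : Fin n → Bool => f (Fin.cons true τ)) -
        cubeMean (fun τ : Fin n → Bool => f (Fin.cons false τ))| ≤ c := by
      have h0 : ∀ τ : Fin n → Bool, |f (Fin.cons true τ) - f (Fin.cons false τ)| ≤ c := by
        intro τ
        have := h (Fin.cons false τ) 0 true
        rwa [Fin.update_cons_zero] at this
      rw [abs_le]
      constructor
      · have := cubeMean_mono (f := fun τ : Fin n → Bool => f (Fin.cons false τ))
          (g := fun τ => f (Fin.cons true τ) + c) (fun τ => by linarith [(abs_le.1 (h0 τ)).1])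
        rw [cubeMean_add, cubeMean_const] at this
        linarith
      · have := cubeMean_mono (f := fun τ : Fin n → Bool => f (Fin.cons true τ))
          (g := fun τ => f (Fin.cons false τ) + c) (fun τ => by linarith [(abs_le.1 (h0 τ)).2])
        rw [cubeMean_add, cubeMean_const] at this
        linarith
    -- The two half-cubes obey the induction hypothesis, and their means differ by at most c, so the
    -- first coordinate costs one more c²/8.
    rw [cubeMean_succ, cubeMean_succ f]
    have h1 := exp_add_exp_le _ _ c hd
    calc _ ≤ (Real.exp (cubeMean (fun τ : Fin n → Bool => f (Fin.cons true τ)) + n * c ^ 2 / 8) +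
          Real.exp (cubeMean (fun τ : Fin n → Bool => f (Fin.cons false τ)) + n * c ^ 2 / 8)) / 2 := by
          linarith [hb true, hb false]
      _ = (Real.exp (cubeMean (fun τ : Fin n → Bool => f (Fin.cons true τ))) +
          Real.exp (cubeMean (fun τ : Fin n → Bool => f (Fin.cons false τ)))) / 2 *
            Real.exp (n * c ^ 2 / 8) := by
          rw [Real.exp_add, Real.exp_add]; ring
      _ ≤ _ := by
          refine (mul_le_mul_of_nonneg_right h1 (Real.exp_pos _).le).trans ?_
          rw [← Real.exp_add]
          refine Real.exp_le_exp.2 (le_of_eq ?_)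
          push_cast
          ring

/-! ### Rademacher sums, Massart's lemma and chaining -/

/-- The Rademacher sum with coefficients `v`. -/
def radSum {n : ℕ} (v : Fin n → ℝ) (τ : Fin n → Bool) : ℝ := ∑ j, sgn (τ j) * v j

lemma radSum_update_sub {n : ℕ} (v : Fin n → ℝ) {r : ℝ} (hv : ∀ j, |v j| ≤ r)
    (τ : Fin n → Bool) (j : Fin n) (b : Bool) :
    |radSum v (Function.update τ j b) - radSum v τ| ≤ 2 * r := by
  have : radSum v (Function.update τ j b) - radSum v τ = (sgn b - sgn (τ j)) * v j := by
    unfold radSum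
    rw [← Finset.sum_sub_distrib, Finset.sum_eq_single j]
    · simp; ring
    · intro i _ hi
      simp [Function.update_of_ne hi]
    · simp
  rw [this, abs_mul]
  have h1 : |sgn b - sgn (τ j)| ≤ 2 := by
    refine (abs_sub _ _).trans ?_
    rw [abs_sgn, abs_sgn]; norm_num
  exact mul_le_mul h1 (hv j) (abs_nonneg _) (by norm_num)

lemma cubeMean_radSum {n : ℕ} (v : Fin n → ℝ) : cubeMean (radSum v) = 0 := by
  induction n with
  | zero => simp [cubeMean, radSum]
  | succ n ih =>
    rw [cubeMean_succ]
    have : ∀ b, (fun τ : Fin n → Bool => radSum v (Fin.cons b τ)) =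
        fun τ => sgn b * v 0 + radSum (fun j => v j.succ) τ := by
      intro b; funext τ; simp [radSum, Fin.sum_univ_succ]
    rw [this, this, cubeMean_add, cubeMean_add, cubeMean_const, cubeMean_const, ih]
    simp [sgn]

lemma radSum_sub {n : ℕ} (v w : Fin n → ℝ) (τ : Fin n → Bool) :
    radSum v τ - radSum w τ = radSum (fun j => v j - w j) τ := by
  simp [radSum, mul_sub]

lemma radSum_le {n : ℕ} (v : Fin n → ℝ) {r : ℝ} (hv : ∀ j, |v j| ≤ r) (τ : Fin n → Bool) :
    radSum v τ ≤ n * r := by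
  unfold radSum
  refine (Finset.sum_le_card_nsmul _ _ r fun j _ => ?_).trans (by simp)
  refine (le_abs_self _).trans ?_
  rw [abs_mul, abs_sgn, one_mul]
  exact hv j

lemma cubeMean_exp_radSum_le {n : ℕ} (v : Fin n → ℝ) {r : ℝ} (hv : ∀ j, |v j| ≤ r) (lam : ℝ) :
    cubeMean (fun τ => Real.exp (lam * radSum v τ)) ≤ Real.exp (n * (lam * r) ^ 2 / 2) := by
  have h := cubeMean_exp_le (fun τ => lam * radSum v τ) (|lam| * (2 * r)) (fun τ j b => by
    rw [← mul_sub, abs_mul]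
    exact mul_le_mul_of_nonneg_left (radSum_update_sub v hv τ j b) (abs_nonneg _))
  rw [cubeMean_mul, cubeMean_radSum] at h
  refine h.trans (le_of_eq ?_)
  congr 1
  rw [mul_pow, sq_abs]
  ring

/-- Jensen's inequality, obtained by averaging the tangent line of exp at the mean. -/
lemma exp_cubeMean_le {n : ℕ} (f : (Fin n → Bool) → ℝ) :
    Real.exp (cubeMean f) ≤ cubeMean (fun τ => Real.exp (f τ)) := by
  have h := cubeMean_mono (f := fun τ => Real.exp (cubeMean f) * (1 - cubeMean f + f τ))
    (g := fun τ => Real.exp (f τ)) (fun τ => by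
      have := Real.add_one_le_exp (f τ - cubeMean f)
      calc _ ≤ Real.exp (cubeMean f) * Real.exp (f τ - cubeMean f) := by
            refine mul_le_mul_of_nonneg_left ?_ (Real.exp_pos _).le
            linarith
        _ = _ := by rw [← Real.exp_add]; ring_nf)
  rw [cubeMean_mul, cubeMean_add, cubeMean_const] at h
  linarith

/-- Massart's finite class lemma. -/
lemma cubeMean_sup_radSum_le {n : ℕ} (hn : 0 < n) {ι : Type*} (s : Finset ι) (hs : s.Nonempty)
    (v : ι → Fin n → ℝ) {r Λ : ℝ} (hr : 0 < r) (hΛ : 0 < Λ) (hv : ∀ i ∈ s, ∀ j, |v i j| ≤ r)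
    (hcard : Real.log s.card ≤ Λ) :
    cubeMean (fun τ => s.sup' hs fun i => radSum (v i) τ) ≤ r * Real.sqrt (2 * n * Λ) := by
  have hn' : (0 : ℝ) < n := by exact_mod_cast hn
  set m := cubeMean (fun τ => s.sup' hs fun i => radSum (v i) τ) with hm
  have key : ∀ lam : ℝ, 0 < lam → lam * m ≤ Λ + n * (lam * r) ^ 2 / 2 := by
    intro lam hlam
    have h1 : Real.exp (lam * m) ≤ s.card * Real.exp (n * (lam * r) ^ 2 / 2) := by
      rw [hm, ← cubeMean_mul]
      refine (exp_cubeMean_le _).trans ?_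
      refine (cubeMean_mono (g := fun τ => ∑ i ∈ s, Real.exp (lam * radSum (v i) τ))
        fun τ => ?_).trans ?_
      · obtain ⟨i, hi, he⟩ := s.exists_mem_eq_sup' hs fun i => radSum (v i) τ
        rw [he]
        exact Finset.single_le_sum (f := fun i => Real.exp (lam * radSum (v i) τ))
          (fun _ _ => (Real.exp_pos _).le) hi
      · rw [cubeMean_sum]
        refine (Finset.sum_le_card_nsmul _ _ _ fun i hi =>
          cubeMean_exp_radSum_le (v i) (hv i hi) lam).trans ?_
        rw [nsmul_eq_mul]
    have hc : (0 : ℝ) < s.card := by exact_mod_cast hs.card_pos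
    have h2 := Real.log_le_log (Real.exp_pos _) h1
    rw [Real.log_exp, Real.log_mul hc.ne' (Real.exp_pos _).ne', Real.log_exp] at h2
    linarith
  set q := Real.sqrt (2 * n * Λ) with hq
  have hq0 : 0 < q := Real.sqrt_pos.2 (by positivity)
  have hqq : q ^ 2 = 2 * n * Λ := Real.sq_sqrt (by positivity)
  -- This is the optimal parameter: it makes both terms on the right of `key` equal to Λ.
  have := key (q / (n * r)) (by positivity)
  have h3 : (n : ℝ) * (q / (n * r) * r) ^ 2 / 2 = Λ := by
    field_simp
    linarith
  rw [h3] at this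
  have h4 : q * m ≤ q * (r * q) := by
    have : q * m = (q / (n * r) * m) * (n * r) := by field_simp
    rw [this]
    have : q * (r * q) = (Λ + Λ) * (n * r) := by
      linear_combination r * hqq
    rw [this]
    gcongr
  exact le_of_mul_le_mul_left h4 hq0

/-- Chaining for Rademacher sums with an entropy of order `4 ^ i * log Q` at scale `D / 2 ^ i`. -/
lemma cubeMean_iSup_radSum_le {n : ℕ} (hn : 0 < n) {T : Type*} [Finite T] [Nonempty T]
    (v : T → Fin n → ℝ) {D Q : ℝ} (hD : 0 < D) (hQ : 1 < Q)
    (cover : ℕ → Finset (Fin n → ℝ)) (hcard₀ : (cover 0).card ≤ 1)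
    (hcard : ∀ i, ((cover i).card : ℝ) ≤ Q ^ (4 ^ i))
    (hcover : ∀ i t, ∃ c ∈ cover i, ∀ j, |v t j - c j| ≤ D / 2 ^ i) (J : ℕ) :
    cubeMean (fun τ => ⨆ t, radSum (v t) τ) ≤
      J * (5 * D * Real.sqrt (n * Real.log Q)) + n * (D / 2 ^ J) := by
  classical
  choose c hc hcv using hcover
  have hlogQ : 0 < Real.log Q := Real.log_pos hQ
  inhabit T
  -- The chaining links: pairs of centres at consecutive scales close enough to approximate a common
  -- point, whence 1 + 1/2 = 3/2.
  let pairs : ℕ → Finset ((Fin n → ℝ) × (Fin n → ℝ)) := fun i =>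
    ((cover i) ×ˢ (cover (i + 1))).filter fun p => ∀ j, |p.2 j - p.1 j| ≤ 3 / 2 * (D / 2 ^ i)
  have hmem : ∀ i t, (c i t, c (i + 1) t) ∈ pairs i := by
    intro i t
    simp only [pairs, Finset.mem_filter, Finset.mem_product]
    refine ⟨⟨hc i t, hc (i + 1) t⟩, fun j => ?_⟩
    have h1 := hcv i t j
    have h2 := hcv (i + 1) t j
    have h3 : D / 2 ^ (i + 1) = D / 2 ^ i / 2 := by rw [pow_succ]; field_simp
    rw [h3] at h2
    rw [abs_le] at *
    constructor <;> linarith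
  have hne : ∀ i, (pairs i).Nonempty := fun i => ⟨_, hmem i default⟩
  let inc : ℕ → (Fin n → Bool) → ℝ := fun i τ =>
    (pairs i).sup' (hne i) fun p => radSum (fun j => p.2 j - p.1 j) τ
  have hinc : ∀ i, cubeMean (inc i) ≤ 5 * D * Real.sqrt (n * Real.log Q) := by
    intro i
    have hpos : (0 : ℝ) < (pairs i).card := by exact_mod_cast (hne i).card_pos
    have hl : Real.log (pairs i).card ≤ 5 * 4 ^ i * Real.log Q := by
      have h1 : ((pairs i).card : ℝ) ≤ Q ^ (5 * 4 ^ i) := by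
        calc ((pairs i).card : ℝ) ≤ (cover i).card * (cover (i + 1)).card := by
              exact_mod_cast (Finset.card_filter_le _ _).trans (Finset.card_product _ _).le
          _ ≤ Q ^ (4 ^ i) * Q ^ (4 ^ (i + 1)) := by
              gcongr
              · exact hcard i
              · exact hcard (i + 1)
          _ = _ := by rw [← pow_add]; ring_nf
      have := Real.log_le_log hpos h1
      rw [Real.log_pow] at this
      exact_mod_cast this
    refine (cubeMean_sup_radSum_le hn (pairs i) (hne i) (fun p j => p.2 j - p.1 j)
      (r := 3 / 2 * (D / 2 ^ i)) (by positivity) (by positivity)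
      (fun p hp => (Finset.mem_filter.1 hp).2) hl).trans ?_
    -- The root of the entropy grows like 2^i and cancels the link length D / 2^i, so every scale
    -- costs the same.
    have h2 : (2 : ℝ) * n * (5 * 4 ^ i * Real.log Q) = (2 ^ i) ^ 2 * (10 * (n * Real.log Q)) := by
      rw [← pow_mul, mul_comm i 2, pow_mul]
      norm_num
      ring
    rw [h2, Real.sqrt_mul (by positivity), Real.sqrt_sq (by positivity),
      Real.sqrt_mul (by positivity)]
    have h3 : Real.sqrt 10 ≤ 10 / 3 := by
      rw [Real.sqrt_le_left (by norm_num)]; norm_num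
    calc _ = 3 / 2 * D * Real.sqrt 10 * Real.sqrt (n * Real.log Q) := by field_simp
      _ ≤ 3 / 2 * D * (10 / 3) * Real.sqrt (n * Real.log Q) := by gcongr
      _ = _ := by ring
  -- The coarsest net has a single centre, so the start of the chain does not depend on t and its
  -- Rademacher sum averages to zero.
  have hc0 : ∀ t, c 0 t = c 0 default := fun t =>
    Finset.card_le_one.1 hcard₀ _ (hc 0 t) _ (hc 0 default)
  have hpt : ∀ τ, (⨆ t, radSum (v t) τ) ≤
      radSum (c 0 default) τ + (∑ i ∈ Finset.range J, inc i τ + n * (D / 2 ^ J)) := by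
    intro τ
    refine ciSup_le fun t => ?_
    have h1 : radSum (v t) τ - radSum (c J t) τ ≤ n * (D / 2 ^ J) := by
      rw [radSum_sub]
      exact radSum_le _ (hcv J t) τ
    have h2 : radSum (c J t) τ - radSum (c 0 t) τ ≤ ∑ i ∈ Finset.range J, inc i τ := by
      rw [← Finset.sum_range_sub (fun i => radSum (c i t) τ)]
      refine Finset.sum_le_sum fun i _ => ?_
      rw [radSum_sub]
      exact Finset.le_sup' (f := fun p : (Fin n → ℝ) × (Fin n → ℝ) =>
        radSum (fun j => p.2 j - p.1 j) τ) (hmem i t)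
    rw [hc0] at h2
    linarith
  refine (cubeMean_mono hpt).trans ?_
  rw [cubeMean_add, cubeMean_add, cubeMean_const, cubeMean_sum,
    show cubeMean (fun τ => radSum (c 0 default) τ) = 0 from cubeMean_radSum _, zero_add]
  gcongr
  refine (Finset.sum_le_card_nsmul _ _ _ fun i _ => hinc i).trans ?_
  simp

lemma abs_iSup_sub_iSup_le {T : Type*} [Finite T] [Nonempty T] (f g : T → ℝ) {c : ℝ}
    (h : ∀ t, |f t - g t| ≤ c) : |(⨆ t, f t) - ⨆ t, g t| ≤ c := by
  rw [abs_le]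
  constructor
  · have : (⨆ t, g t) ≤ (⨆ t, f t) + c := ciSup_le fun t => by
      linarith [(abs_le.1 (h t)).1, le_ciSup (Set.finite_range f).bddAbove t]
    linarith
  · have : (⨆ t, f t) ≤ (⨆ t, g t) + c := ciSup_le fun t => by
      linarith [(abs_le.1 (h t)).2, le_ciSup (Set.finite_range g).bddAbove t]
    linarith

/-! ### Symmetrization and uniform deviations -/

section Deviation

variable {Z T : Type*}

/-- The exponential moment of a symmetrized supremum is controlled by the Rademacher averages. -/
lemma integral_exp_symmetrized_le [MeasurableSpace Z] (P : Measure Z) [IsProbabilityMeasure P]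
    [Finite T] [Nonempty T] {n : ℕ} (g : T → Z → ℝ) (hg : ∀ t, Measurable (g t))
    (hg01 : ∀ t z, g t z ∈ Set.Icc (0 : ℝ) 1) (β : ℝ)
    (hβ : ∀ ω : Fin n → Z × Z,
      cubeMean (fun τ => ⨆ t, radSum (fun j => g t (ω j).2 - g t (ω j).1) τ) ≤ β)
    (lam : ℝ) (hlam : 0 ≤ lam) :
    ∫ ω, Real.exp (lam * ⨆ t, ∑ j, (g t (ω j).2 - g t (ω j).1))
        ∂(Measure.pi fun _ : Fin n => P.prod P) ≤
      Real.exp (lam * β + n * lam ^ 2 / 2) := by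
  classical
  set μ : Measure (Fin n → Z × Z) := Measure.pi fun _ : Fin n => P.prod P
  have hh : ∀ (ω : Fin n → Z × Z) t j, |g t (ω j).2 - g t (ω j).1| ≤ 1 := by
    intro ω t j
    have h1 := hg01 t (ω j).1
    have h2 := hg01 t (ω j).2
    rw [abs_le]
    constructor <;> linarith [h1.1, h1.2, h2.1, h2.2]
  let Ψ : (Fin n → Bool) → (Fin n → Z × Z) → ℝ := fun τ ω =>
    Real.exp (lam * ⨆ t, radSum (fun j => g t (ω j).2 - g t (ω j).1) τ)
  have hΨm : ∀ τ, Measurable (Ψ τ) := by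
    intro τ
    refine Real.measurable_exp.comp (Measurable.const_mul (Measurable.iSup fun t => ?_) lam)
    unfold radSum
    have := hg t
    fun_prop
  have hΨi : ∀ τ, Integrable (Ψ τ) μ := by
    intro τ
    refine Integrable.of_bound (hΨm τ).aestronglyMeasurable (Real.exp (lam * (n * 1))) ?_
    refine Filter.Eventually.of_forall fun ω => ?_
    rw [Real.norm_eq_abs, abs_of_pos (Real.exp_pos _)]
    refine Real.exp_le_exp.2 (mul_le_mul_of_nonneg_left (ciSup_le fun t => ?_) hlam)
    exact radSum_le _ (hh ω t) τ
  -- Exchanging a sample point with its ghost preserves P × P and changes the sign of the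
  -- corresponding summand.
  have hflip : ∀ τ : Fin n → Bool,
      ∫ ω, Real.exp (lam * ⨆ t, ∑ j, (g t (ω j).2 - g t (ω j).1)) ∂μ = ∫ ω, Ψ τ ω ∂μ := by
    intro τ
    have hmp : MeasurePreserving (fun (ω : Fin n → Z × Z) j =>
        (if τ j then id else Prod.swap : Z × Z → Z × Z) (ω j)) μ μ := by
      refine measurePreserving_pi _ _ fun j => ?_
      by_cases hτ : τ j = true
      · simpa [hτ] using MeasurePreserving.id (P.prod P)
      · simpa [hτ] using (Measure.measurePreserving_swap (μ := P) (ν := P))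
    have hm : Measurable fun ω : Fin n → Z × Z =>
        Real.exp (lam * ⨆ t, ∑ j, (g t (ω j).2 - g t (ω j).1)) := by
      refine Real.measurable_exp.comp (Measurable.const_mul (Measurable.iSup fun t => ?_) lam)
      have := hg t
      fun_prop
    have h1 := integral_map (μ := μ) hmp.measurable.aemeasurable
      (f := fun ω => Real.exp (lam * ⨆ t, ∑ j, (g t (ω j).2 - g t (ω j).1)))
      hm.aestronglyMeasurable
    rw [hmp.map_eq] at h1
    rw [h1]
    refine integral_congr_ae (Filter.Eventually.of_forall fun ω => ?_)
    simp only [Ψ, radSum]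
    congr 2
    refine iSup_congr fun t => Finset.sum_congr rfl fun j _ => ?_
    by_cases hτ : τ j = true
    · simp [hτ, sgn]
    · simp [hτ, sgn]
  -- With ω frozen, flipping one sign moves the supremum by at most 2, so bounded differences give
  -- n(2·lam)²/8 = n·lam²/2.
  have hpt : ∀ ω, cubeMean (fun τ => Ψ τ ω) ≤ Real.exp (lam * β + n * lam ^ 2 / 2) := by
    intro ω
    refine (cubeMean_exp_le _ (lam * (2 * 1)) fun τ j b => ?_).trans (Real.exp_le_exp.2 ?_)
    · rw [← mul_sub, abs_mul, abs_of_nonneg hlam]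
      refine mul_le_mul_of_nonneg_left (abs_iSup_sub_iSup_le _ _ fun t => ?_) hlam
      exact radSum_update_sub _ (hh ω t) τ j b
    · rw [cubeMean_mul]
      have := mul_le_mul_of_nonneg_left (hβ ω) hlam
      linarith
  calc _ = cubeMean (fun τ => ∫ ω, Ψ τ ω ∂μ) := by
        simp_rw [← hflip]; rw [cubeMean_const]
    _ = ∫ ω, cubeMean (fun τ => Ψ τ ω) ∂μ := by
        simp only [cubeMean]
        rw [integral_div, integral_finsetSum _ fun τ _ => hΨi τ]
    _ ≤ ∫ _, Real.exp (lam * β + n * lam ^ 2 / 2) ∂μ := by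
        refine integral_mono ?_ (integrable_const _) hpt
        simp only [cubeMean]
        exact (integrable_finsetSum _ fun τ _ => hΨi τ).div_const _
    _ = _ := by simp

/-- Symmetrization for exponential moments of the uniform deviation. -/
lemma integral_exp_deviation_le [MeasurableSpace Z] (P : Measure Z) [IsProbabilityMeasure P]
    [Finite T] [Nonempty T] {n : ℕ} (g : T → Z → ℝ) (hg : ∀ t, Measurable (g t))
    (hg01 : ∀ t z, g t z ∈ Set.Icc (0 : ℝ) 1) (lam : ℝ) (hlam : 0 ≤ lam) :
    ∫ S : Fin n → Z, Real.exp (lam * ⨆ t, ∑ j, ((∫ z, g t z ∂P) - g t (S j)))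
        ∂(Measure.pi fun _ : Fin n => P) ≤
      ∫ ω, Real.exp (lam * ⨆ t, ∑ j, (g t (ω j).2 - g t (ω j).1))
        ∂(Measure.pi fun _ : Fin n => P.prod P) := by
  set μ : Measure (Fin n → Z) := Measure.pi fun _ : Fin n => P
  let Φ : (Fin n → Z) × (Fin n → Z) → ℝ := fun p =>
    Real.exp (lam * ⨆ t, ∑ j, (g t (p.2 j) - g t (p.1 j)))
  have hΦm : Measurable Φ := by
    refine Real.measurable_exp.comp (Measurable.const_mul (Measurable.iSup fun t => ?_) lam)
    have := hg t
    fun_prop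
  have hsum : ∀ (p : (Fin n → Z) × (Fin n → Z)) t, ∑ j, (g t (p.2 j) - g t (p.1 j)) ≤ n := by
    intro p t
    refine (Finset.sum_le_card_nsmul _ _ 1 fun j _ => ?_).trans (by simp)
    linarith [(hg01 t (p.2 j)).2, (hg01 t (p.1 j)).1]
  have hΦb : ∀ p, ‖Φ p‖ ≤ Real.exp (lam * n) := by
    intro p
    rw [Real.norm_eq_abs, abs_of_pos (Real.exp_pos _)]
    exact Real.exp_le_exp.2 (mul_le_mul_of_nonneg_left (ciSup_le fun t => hsum p t) hlam)
  have hΦi : Integrable Φ (μ.prod μ) :=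
    Integrable.of_bound hΦm.aestronglyMeasurable _ (Filter.Eventually.of_forall hΦb)
  have hgi : ∀ t, Integrable (g t) P := fun t =>
    Integrable.of_bound (hg t).aestronglyMeasurable 1 (Filter.Eventually.of_forall fun z => by
      rw [Real.norm_eq_abs, abs_of_nonneg (hg01 t z).1]; exact (hg01 t z).2)
  have hgei : ∀ t (j : Fin n), Integrable (fun S : Fin n → Z => g t (S j)) μ := fun t j =>
    ((measurePreserving_eval (fun _ : Fin n => P) j).integrable_comp
      (hg t).aestronglyMeasurable).2 (hgi t)
  have hRHS : ∫ ω, Real.exp (lam * ⨆ t, ∑ j, (g t (ω j).2 - g t (ω j).1))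
        ∂(Measure.pi fun _ : Fin n => P.prod P) = ∫ p, Φ p ∂(μ.prod μ) := by
    have hmp := measurePreserving_arrowProdEquivProdArrow Z Z (Fin n) (fun _ => P) (fun _ => P)
    rw [← hmp.integral_comp' Φ]
    rfl
  rw [hRHS, integral_prod _ hΦi]
  have hinner : Integrable (fun S => ∫ S', Φ (S, S') ∂μ) μ := hΦi.integral_prod_left
  refine integral_mono_of_nonneg (Filter.Eventually.of_forall fun _ => (Real.exp_pos _).le) hinner
    (Filter.Eventually.of_forall fun S => ?_)
  -- For fixed S the maximiser t is fixed. Jensen in the ghost sample S' is applied to this t, by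
  -- integrating the tangent line of exp at lam * m.
  obtain ⟨t, ht⟩ := exists_eq_ciSup_of_finite (f := fun t =>
    ∑ j, ((∫ z, g t z ∂P) - g t (S j)))
  simp only
  rw [← ht]
  set m := ∑ j : Fin n, ((∫ z, g t z ∂P) - g t (S j)) with hm
  have hdi : ∀ j, Integrable (fun S' : Fin n → Z => g t (S' j) - g t (S j)) μ :=
    fun j => (hgei t j).sub (integrable_const _)
  have hmean : ∫ S', ∑ j, (g t (S' j) - g t (S j)) ∂μ = m := by
    rw [integral_finsetSum _ fun j _ => hdi j]
    refine Finset.sum_congr rfl fun j _ => ?_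
    rw [integral_sub (hgei t j) (integrable_const _),
      integral_comp_eval (μ := fun _ : Fin n => P) (hg t).aestronglyMeasurable]
    simp
  have hsi : Integrable (fun S' : Fin n → Z => ∑ j, (g t (S' j) - g t (S j))) μ :=
    integrable_finsetSum _ fun j _ => hdi j
  calc Real.exp (lam * m)
      = ∫ S', Real.exp (lam * m) * (1 - lam * m + lam * ∑ j, (g t (S' j) - g t (S j))) ∂μ := by
        rw [integral_const_mul, integral_add (integrable_const _) (hsi.const_mul _),
          integral_const_mul, hmean]
        simp
    _ ≤ ∫ S', Φ (S, S') ∂μ := by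
        refine integral_mono (((integrable_const _).add (hsi.const_mul _)).const_mul _)
          (Integrable.of_bound (hΦm.comp measurable_prodMk_left).aestronglyMeasurable _
            (Filter.Eventually.of_forall fun S' => hΦb (S, S'))) fun S' => ?_
        set q := ∑ j, (g t (S' j) - g t (S j)) with hq
        have h1 := Real.add_one_le_exp (lam * q - lam * m)
        calc _ ≤ Real.exp (lam * m) * Real.exp (lam * q - lam * m) := by
              refine mul_le_mul_of_nonneg_left ?_ (Real.exp_pos _).le
              linarith
          _ = Real.exp (lam * q) := by rw [← Real.exp_add]; ring_nf
          _ ≤ _ := Real.exp_le_exp.2 (mul_le_mul_of_nonneg_left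
              (le_ciSup (f := fun t => ∑ j, (g t (S' j) - g t (S j)))
                (Set.finite_range _).bddAbove t) hlam)

/-- The uniform deviation inequality for a finite class. -/
lemma measure_deviation_finite_le [MeasurableSpace Z] (P : Measure Z) [IsProbabilityMeasure P]
    [Finite T] [Nonempty T] {n : ℕ} (g : T → Z → ℝ) (hg : ∀ t, Measurable (g t))
    (hg01 : ∀ t z, g t z ∈ Set.Icc (0 : ℝ) 1) (β : ℝ)
    (hβ : ∀ ω : Fin n → Z × Z,
      cubeMean (fun τ => ⨆ t, radSum (fun j => g t (ω j).2 - g t (ω j).1) τ) ≤ β)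
    (u : ℝ) (hu : 0 ≤ u) :
    (Measure.pi fun _ : Fin n => P)
        {S | ∃ t, β + n * u ≤ ∑ j, ((∫ z, g t z ∂P) - g t (S j))} ≤
      ENNReal.ofReal (Real.exp (-(n * u ^ 2 / 2))) := by
  set μ : Measure (Fin n → Z) := Measure.pi fun _ : Fin n => P
  let X : (Fin n → Z) → ℝ := fun S => ⨆ t, ∑ j, ((∫ z, g t z ∂P) - g t (S j))
  have hXm : Measurable X := by
    refine Measurable.iSup fun t => ?_
    have := hg t
    fun_prop
  have hint : ∀ t, ∫ z, g t z ∂P ≤ 1 := by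
    intro t
    refine (integral_mono_of_nonneg (Filter.Eventually.of_forall fun z => (hg01 t z).1)
      (integrable_const (1 : ℝ)) (Filter.Eventually.of_forall fun z => (hg01 t z).2)).trans ?_
    simp
  have hXi : Integrable (fun S => Real.exp (u * X S)) μ := by
    refine Integrable.of_bound
      (Real.measurable_exp.comp (hXm.const_mul u)).aestronglyMeasurable (Real.exp (u * n))
      (Filter.Eventually.of_forall fun S => ?_)
    rw [Real.norm_eq_abs, abs_of_pos (Real.exp_pos _)]
    refine Real.exp_le_exp.2 (mul_le_mul_of_nonneg_left (ciSup_le fun t => ?_) hu)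
    refine (Finset.sum_le_card_nsmul _ _ 1 fun j _ => ?_).trans (by simp)
    linarith [hint t, (hg01 t (S j)).1]
  -- Chernoff's bound with parameter u itself, which minimises -lam·nu + n·lam²/2.
  have h1 := ProbabilityTheory.measure_ge_le_exp_mul_mgf (μ := μ) (X := X) (β + n * u) hu hXi
  have h2 : ProbabilityTheory.mgf X μ u ≤ Real.exp (u * β + n * u ^ 2 / 2) :=
    (integral_exp_deviation_le P g hg hg01 u hu).trans
      (integral_exp_symmetrized_le P g hg hg01 β hβ u hu)
  have h3 : μ.real {S | β + n * u ≤ X S} ≤ Real.exp (-(n * u ^ 2 / 2)) := by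
    refine h1.trans ((mul_le_mul_of_nonneg_left h2 (Real.exp_pos _).le).trans ?_)
    rw [← Real.exp_add]
    exact Real.exp_le_exp.2 (le_of_eq (by ring))
  refine (measure_mono (t := {S | β + n * u ≤ X S}) ?_).trans
    ((ENNReal.le_ofReal_iff_toReal_le (measure_ne_top _ _) (Real.exp_pos _).le).2 h3)
  rintro S ⟨t, ht⟩
  exact ht.trans (le_ciSup (f := fun t => ∑ j, ((∫ z, g t z ∂P) - g t (S j)))
    (Set.finite_range _).bddAbove t)

/-- The uniform deviation inequality for a sequence of functions. -/
lemma measure_deviation_seq_le [MeasurableSpace Z] (P : Measure Z) [IsProbabilityMeasure P]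
    {n : ℕ} (g : ℕ → Z → ℝ) (hg : ∀ t, Measurable (g t))
    (hg01 : ∀ t z, g t z ∈ Set.Icc (0 : ℝ) 1) (β : ℝ)
    (hβ : ∀ (N : ℕ) (ω : Fin n → Z × Z),
      cubeMean (fun τ => ⨆ t : Fin (N + 1), radSum (fun j => g t (ω j).2 - g t (ω j).1) τ) ≤ β)
    (u : ℝ) (hu : 0 ≤ u) :
    (Measure.pi fun _ : Fin n => P)
        {S | ∃ t, β + n * u ≤ ∑ j, ((∫ z, g t z ∂P) - g t (S j))} ≤
      ENNReal.ofReal (Real.exp (-(n * u ^ 2 / 2))) := by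
  let E : ℕ → Set (Fin n → Z) := fun N =>
    {S | ∃ t : Fin (N + 1), β + n * u ≤ ∑ j, ((∫ z, g t z ∂P) - g t (S j))}
  have hE : {S : Fin n → Z | ∃ t, β + n * u ≤ ∑ j, ((∫ z, g t z ∂P) - g t (S j))} = ⋃ N, E N := by
    ext S
    simp only [E, Set.mem_iUnion]
    constructor
    · rintro ⟨t, ht⟩
      exact ⟨t, ⟨t, Nat.lt_succ_self t⟩, ht⟩
    · rintro ⟨N, t, ht⟩
      exact ⟨t, ht⟩
  have hmono : Monotone E := by
    rintro N N' hN S ⟨t, ht⟩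
    exact ⟨⟨t, by omega⟩, ht⟩
  -- Since β does not depend on N, the bound survives the increasing union.
  rw [hE, hmono.measure_iUnion]
  exact iSup_le fun N => measure_deviation_finite_le P (fun t : Fin (N + 1) => g t)
    (fun t => hg t) (fun t => hg01 t) β (hβ N) u hu

end Deviation

/-! ### Covering a ball of matrices -/

/-- The perceptron covering of a ball for the supremum of finitely many linear functionals. -/
lemma exists_perceptron_cover {H ι : Type*} [NormedAddCommGroup H] [InnerProductSpace ℝ H]
    [Fintype ι] (x : ι → H) {β ε : ℝ} (hβ : 0 < β) (hε : 0 < ε) (hx : ∀ i, ‖x i‖ ≤ β) (N : ℕ) :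
    ∃ U : Finset H, 0 ∈ U ∧ U.card ≤ (2 * Fintype.card ι + 1) ^ N ∧
      ∀ w : H, ‖w‖ ^ 2 * β ^ 2 ≤ N * ε ^ 2 → ∃ u ∈ U, ∀ i, |inner ℝ (w - u) (x i)| ≤ ε := by
  classical
  induction N with
  | zero =>
    refine ⟨{0}, by simp, by simp, fun w hw => ⟨0, by simp, fun i => ?_⟩⟩
    have : w = 0 := by
      by_contra h
      have : 0 < ‖w‖ ^ 2 * β ^ 2 := by positivity
      simp at hw
      linarith
    simp [this, hε.le]
  | succ N ih =>
    obtain ⟨U, h0, hcard, hU⟩ := ih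
    -- A perceptron update: subtracting it when some |⟨w, x i⟩| exceeds ε lowers ‖w‖²β² by at least
    -- ε², so N updates suffice. `none` means that no update is made.
    let step : Option (ι × Bool) → H := fun o =>
      o.elim 0 fun p => (sgn p.2 * (ε / β ^ 2)) • x p.1
    refine ⟨(U ×ˢ (Finset.univ : Finset (Option (ι × Bool)))).image fun p => p.1 + step p.2,
      ?_, ?_, fun w hw => ?_⟩
    · exact Finset.mem_image.2 ⟨(0, none), by simp [h0], by simp [step]⟩
    · refine Finset.card_image_le.trans ?_
      rw [Finset.card_product, pow_succ, Finset.card_univ, Fintype.card_option, Fintype.card_prod,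
        Fintype.card_bool, mul_comm (Fintype.card ι)]
      exact Nat.mul_le_mul_right _ hcard
    · by_cases hgood : ∀ i, |inner ℝ w (x i)| ≤ ε
      · exact ⟨0, Finset.mem_image.2 ⟨(0, none), by simp [h0], by simp [step]⟩, by simpa using hgood⟩
      · push Not at hgood
        obtain ⟨i, hi⟩ := hgood
        obtain ⟨b, hb⟩ : ∃ b, ε < sgn b * inner ℝ w (x i) := by
          rcases lt_abs.1 hi with h | h
          · exact ⟨true, by simpa [sgn] using h⟩
          · exact ⟨false, by simpa [sgn] using h⟩
        have hs2 : sgn b ^ 2 = 1 := by rw [← sq_abs, abs_sgn, one_pow]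
        have hnorm : ‖w - step (some (i, b))‖ ^ 2 * β ^ 2 ≤ N * ε ^ 2 := by
          simp only [step, Option.elim]
          rw [norm_sub_sq_real, inner_smul_right, norm_smul, mul_pow, Real.norm_eq_abs, sq_abs,
            mul_pow, hs2]
          have h1 : ‖x i‖ ^ 2 ≤ β ^ 2 := by gcongr; exact hx i
          have h2 : (ε / β ^ 2) ^ 2 * ‖x i‖ ^ 2 ≤ (ε / β ^ 2) ^ 2 * β ^ 2 := by gcongr
          have h3 : (ε / β ^ 2) * ε ≤ (ε / β ^ 2) * (sgn b * inner ℝ w (x i)) := by gcongr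
          have h4 : (ε / β ^ 2) ^ 2 * β ^ 2 * β ^ 2 = ε ^ 2 := by field_simp
          have h5 : (ε / β ^ 2) * ε * β ^ 2 = ε ^ 2 := by field_simp
          push_cast at hw
          nlinarith [mul_le_mul_of_nonneg_right h2 (sq_nonneg β),
            mul_le_mul_of_nonneg_right h3 (sq_nonneg β)]
        obtain ⟨u, hu, hui⟩ := hU _ hnorm
        refine ⟨u + step (some (i, b)), Finset.mem_image.2 ⟨(u, some (i, b)), by simp [hu], rfl⟩,
          fun i' => ?_⟩
        have := hui i'
        rwa [sub_sub, add_comm] at this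

/-- Finitely many vectors of natural numbers with a bounded sum. -/
lemma exists_finset_sum_le (m N : ℕ) :
    ∃ S : Finset (Fin m → ℕ), S.card ≤ (m + 1) ^ N ∧ (∀ t ∈ S, ∑ r, t r ≤ N) ∧
      ∀ t : Fin m → ℕ, ∑ r, t r ≤ N → t ∈ S := by
  classical
  induction N with
  | zero =>
    refine ⟨{0}, by simp, by simp, fun t ht => ?_⟩
    simp only [Nat.le_zero, Finset.sum_eq_zero_iff, Finset.mem_univ, true_imp_iff] at ht
    exact Finset.mem_singleton.2 (funext ht)
  | succ N ih =>
    obtain ⟨S, hcard, hS, hmem⟩ := ih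
    let inc : (Fin m → ℕ) → Option (Fin m) → Fin m → ℕ := fun t o =>
      o.elim t fun r => t + Pi.single r 1
    refine ⟨(S ×ˢ (Finset.univ : Finset (Option (Fin m)))).image fun p => inc p.1 p.2, ?_, ?_, ?_⟩
    · refine Finset.card_image_le.trans ?_
      rw [Finset.card_product, pow_succ, Finset.card_univ, Fintype.card_option, Fintype.card_fin]
      exact Nat.mul_le_mul_right _ hcard
    · intro t ht
      obtain ⟨⟨t', o⟩, hp, rfl⟩ := Finset.mem_image.1 ht
      have h1 := hS t' (Finset.mem_product.1 hp).1
      cases o with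
      | none => exact h1.trans (Nat.le_succ N)
      | some r => simpa [inc, Finset.sum_add_distrib] using h1
    · intro t ht
      by_cases h : ∑ r, t r ≤ N
      · exact Finset.mem_image.2 ⟨(t, none), by simp [hmem t h], rfl⟩
      · have : ∑ r, t r ≠ 0 := by omega
        obtain ⟨r, -, hr⟩ := Finset.exists_ne_zero_of_sum_ne_zero this
        obtain ⟨t', rfl⟩ : ∃ t' : Fin m → ℕ, t = t' + Pi.single r 1 := by
          refine ⟨t - Pi.single r 1, (tsub_add_cancel_of_le fun r' => ?_).symm⟩
          by_cases hrr : r' = r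
          · subst hrr
            rw [Pi.single_eq_same]
            exact Nat.one_le_iff_ne_zero.2 hr
          · simp [hrr]
        refine Finset.mem_image.2 ⟨(t', some r), ?_, rfl⟩
        simp only [Finset.mem_product, Finset.mem_univ, and_true]
        refine hmem _ ?_
        simpa [Finset.sum_add_distrib] using ht

/-- A row of a matrix as a Euclidean vector. -/
def rowVec {m p : ℕ} (A : Matrix (Fin m) (Fin p) ℝ) (r : Fin m) : Vec p := WithLp.toLp 2 (A r)

lemma mulVecLin_apply_eq_inner {m p : ℕ} (A : Matrix (Fin m) (Fin p) ℝ) (x : Vec p) (r : Fin m) :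
    mulVecLin A x r = inner ℝ (rowVec A r) x := by
  simp [mulVecLin, rowVec, PiLp.inner_apply, Matrix.mulVec, dotProduct, mul_comm]

lemma norm21_transpose {m p : ℕ} (B : Matrix (Fin m) (Fin p) ℝ) :
    norm21 B.transpose = ∑ r, ‖rowVec B r‖ := by
  simp [norm21, rowVec, EuclideanSpace.norm_eq]

/-- The covering of a ball of the `(2,1)` norm for the maximal Euclidean norm over finitely many
points. -/
lemma exists_matrix_cover {m p : ℕ} {ι : Type*} [Fintype ι] (x : ι → Vec p) {a β ε : ℝ}
    (ha : 0 < a) (hβ : 0 < β) (hε : 0 < ε) (hx : ∀ i, ‖x i‖ ≤ β) (M : Matrix (Fin m) (Fin p) ℝ) :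
    ∃ U : Finset (Matrix (Fin m) (Fin p) ℝ),
      U.card ≤ ((m + 1) * (2 * Fintype.card ι + 1) ^ 2) ^ ⌊a ^ 2 * β ^ 2 / ε ^ 2⌋₊ ∧
      ∀ A, norm21 (A - M).transpose ≤ a →
        ∃ V ∈ U, ∀ i, ‖mulVecLin A (x i) - mulVecLin V (x i)‖ ≤ 2 * ε := by
  classical
  set N := ⌊a ^ 2 * β ^ 2 / ε ^ 2⌋₊ with hN
  -- Unit of row norm: a row gets the integer weight ⌊‖row‖ / θ⌋, and the weights add up to at most
  -- a / θ, hence to at most N.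
  set θ := ε ^ 2 / (a * β ^ 2) with hθ
  have hθ0 : 0 < θ := by positivity
  have haθ : a / θ = a ^ 2 * β ^ 2 / ε ^ 2 := by rw [hθ]; field_simp
  obtain ⟨S, hScard, hSsum, hSmem⟩ := exists_finset_sum_le m N
  -- The accuracy used for a row with weight `t`.
  let acc : ℕ → ℝ := fun t => if t = 0 then ε else Real.sqrt (2 * t * θ * ε ^ 2 / a)
  have hacc : ∀ t, 0 < acc t := by
    intro t
    by_cases ht : t = 0
    · simp [acc, ht, hε]
    · have : (0 : ℝ) < t := by exact_mod_cast Nat.pos_of_ne_zero ht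
      simp only [acc, ht, if_false]
      positivity
  choose R hR0 hRcard hR using fun t : ℕ =>
    exists_perceptron_cover x hβ (hacc t) hx (2 * t)
  let toM : (Fin m → Vec p) → Matrix (Fin m) (Fin p) ℝ := fun u r j => M r j + u r j
  refine ⟨(S.biUnion fun t => Fintype.piFinset fun r => R (t r)).image toM, ?_, fun A hA => ?_⟩
  · refine Finset.card_image_le.trans (Finset.card_biUnion_le.trans ?_)
    refine (Finset.sum_le_card_nsmul _ _ ((2 * Fintype.card ι + 1) ^ (2 * N)) fun t ht => ?_).trans ?_
    · rw [Fintype.card_piFinset]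
      refine (Finset.prod_le_prod' fun r _ => hRcard (t r)).trans ?_
      rw [Finset.prod_pow_eq_pow_sum, ← Finset.mul_sum]
      exact Nat.pow_le_pow_right (Nat.succ_pos _) (Nat.mul_le_mul_left 2 (hSsum t ht))
    · rw [smul_eq_mul, mul_pow, ← pow_mul]
      exact Nat.mul_le_mul_right _ hScard
  · rw [norm21_transpose] at hA
    set B := A - M with hB
    let t : Fin m → ℕ := fun r => ⌊‖rowVec B r‖ / θ⌋₊
    have htle : ∀ r, (t r : ℝ) ≤ ‖rowVec B r‖ / θ := fun r => Nat.floor_le (by positivity)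
    have htlt : ∀ r, ‖rowVec B r‖ < (t r + 1) * θ := fun r => by
      have := Nat.lt_floor_add_one (‖rowVec B r‖ / θ)
      rwa [div_lt_iff₀ hθ0] at this
    have hsumt : (∑ r, (t r : ℝ)) ≤ a / θ := by
      refine (Finset.sum_le_sum fun r _ => htle r).trans ?_
      rw [← Finset.sum_div]
      gcongr
    have htS : t ∈ S := by
      refine hSmem t (Nat.le_floor ?_)
      rw [← haθ]
      exact_mod_cast hsumt
    have hrow : ∀ r, ∃ u ∈ R (t r), ∀ i,
        |inner ℝ (rowVec B r - u) (x i)| ^ 2 ≤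
          ‖rowVec B r‖ * θ * β ^ 2 + 2 * t r * θ * ε ^ 2 / a := by
      intro r
      -- A row of weight 0 is replaced by the reference row, since its norm is at most θ. Otherwise
      -- ‖row‖ ≤ (t + 1)θ ≤ 2tθ, which is what 2t updates can handle.
      by_cases ht0 : t r = 0
      · refine ⟨0, hR0 _, fun i => ?_⟩
        have h1 : ‖rowVec B r‖ ≤ θ := by
          have := htlt r
          rw [ht0] at this
          simpa using this.le
        have h2 : |inner ℝ (rowVec B r - 0) (x i)| ≤ ‖rowVec B r‖ * β := by
          rw [sub_zero]
          exact (abs_real_inner_le_norm _ _).trans (by gcongr; exact hx i)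
        calc _ ≤ (‖rowVec B r‖ * β) ^ 2 := by gcongr
          _ = ‖rowVec B r‖ * ‖rowVec B r‖ * β ^ 2 := by ring
          _ ≤ ‖rowVec B r‖ * θ * β ^ 2 := by gcongr
          _ ≤ _ := by simp [ht0]
      · have ht1 : (1 : ℝ) ≤ t r := by exact_mod_cast Nat.pos_of_ne_zero ht0
        have hacc2 : acc (t r) ^ 2 = 2 * t r * θ * ε ^ 2 / a := by
          simp only [acc, ht0, if_false]
          exact Real.sq_sqrt (by positivity)
        obtain ⟨u, hu, hui⟩ := hR (t r) (rowVec B r) (by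
          rw [hacc2]
          have h1 : ‖rowVec B r‖ ≤ 2 * t r * θ := (htlt r).le.trans (by nlinarith)
          calc ‖rowVec B r‖ ^ 2 * β ^ 2 ≤ (2 * t r * θ) ^ 2 * β ^ 2 := by gcongr
            _ = 2 * t r * (2 * t r * θ * (θ * β ^ 2)) := by ring
            _ = 2 * t r * (2 * t r * θ * (ε ^ 2 / a)) := by
                congr 2; rw [hθ]; field_simp
            _ = _ := by push_cast; ring)
        refine ⟨u, hu, fun i => ?_⟩
        calc _ ≤ acc (t r) ^ 2 := by gcongr; exact hui i
          _ ≤ _ := by rw [hacc2]; simp; positivity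
    choose u huR hu using hrow
    refine ⟨toM u, Finset.mem_image.2 ⟨u, Finset.mem_biUnion.2
      ⟨t, htS, Fintype.mem_piFinset.2 huR⟩, rfl⟩, fun i => ?_⟩
    refine le_of_sq_le_sq ?_ (by positivity)
    rw [EuclideanSpace.norm_sq_eq]
    have hcoord : ∀ r, ‖(mulVecLin A (x i) - mulVecLin (toM u) (x i)) r‖ ^ 2 ≤
        ‖rowVec B r‖ * θ * β ^ 2 + 2 * t r * θ * ε ^ 2 / a := by
      intro r
      refine le_trans (le_of_eq ?_) (hu r i)
      rw [PiLp.sub_apply, mulVecLin_apply_eq_inner, mulVecLin_apply_eq_inner, ← inner_sub_left,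
        Real.norm_eq_abs]
      congr 3
      ext j
      simp [rowVec, toM, hB]
      ring
    refine (Finset.sum_le_sum fun r _ => hcoord r).trans ?_
    rw [Finset.sum_add_distrib, ← Finset.sum_mul, ← Finset.sum_mul, ← Finset.sum_div,
      ← Finset.sum_mul, ← Finset.sum_mul, ← Finset.mul_sum]
    have h1 : (∑ r, ‖rowVec B r‖) * θ * β ^ 2 ≤ ε ^ 2 := by
      calc _ ≤ a * θ * β ^ 2 := by gcongr
        _ = ε ^ 2 := by rw [hθ]; field_simp
    have h2 : 2 * (∑ r, (t r : ℝ)) * θ * ε ^ 2 / a ≤ 2 * ε ^ 2 := by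
      calc _ ≤ 2 * (a / θ) * θ * ε ^ 2 / a := by gcongr
        _ = _ := by field_simp
    -- The two error sums are at most ε² and 2ε², and 3ε² ≤ (2ε)².
    nlinarith

/-! ### Covering a class of networks -/

lemma subnet_congr {d : ℕ → ℕ} (σ : Activations d) {A A' : Weights d} {u : ℕ}
    (h : ∀ l < u, A l = A' l) : subnet σ A u = subnet σ A' u := by
  induction u with
  | zero => rfl
  | succ u ih =>
    funext x
    simp only [subnet]
    rw [ih fun l hl => h l (hl.trans (Nat.lt_succ_self u)), h u (Nat.lt_succ_self u)]

/-- The propagated error of a network whose layer `l` is approximated up to `2 * ε l`. -/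
def netErr (s ρ ε : ℕ → ℝ) : ℕ → ℝ
  | 0 => 0
  | u + 1 => ρ u * (s u * netErr s ρ ε u + 2 * ε u)

/-- Unrolled recursion: the error made in layer l passes through its activation and is then
amplified by the Lipschitz constants of the later layers. -/
lemma netErr_succ_eq_sum (s ρ ε : ℕ → ℝ) (u : ℕ) :
    netErr s ρ ε (u + 1) =
      ∑ l ∈ Finset.range (u + 1), 2 * ε l * (ρ l * ∏ m ∈ Finset.Ioc l u, s m * ρ m) := by
  induction u with
  | zero => simp [netErr]; ring
  | succ u ih =>
    rw [netErr, ih, Finset.sum_range_succ _ (u + 1), mul_add, Finset.mul_sum, Finset.mul_sum]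
    congr 1
    · refine Finset.sum_congr rfl fun l hl => ?_
      rw [Finset.prod_Ioc_succ_top (Nat.lt_succ_iff.1 (Finset.mem_range.1 hl))]
      ring
    · simp; ring

/-- `rhoHat` measures amplification relative to the bound at the layer reached, so one accuracy for
layer l serves all later layers at once. -/
lemma prod_le_mul_rhoHat (L : ℕ) (ρ s b : ℕ → ℝ) {l u : ℕ} (hlu : l ≤ u) (hu : u < L)
    (hρ : 0 < ρ l) (hb : 0 < b (u + 1)) :
    ρ l * ∏ m ∈ Finset.Ioc l u, s m * ρ m ≤ b (u + 1) * rhoHat L ρ s b l := by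
  have h := le_ciSup (f := fun u : Set.Ico l L =>
    (b (u + 1))⁻¹ * ∏ m ∈ Finset.Ioc l (u : ℕ), s m * ρ m) (Set.finite_range _).bddAbove
    ⟨u, hlu, hu⟩
  unfold rhoHat
  calc ρ l * ∏ m ∈ Finset.Ioc l u, s m * ρ m
      = b (u + 1) * (ρ l * ((b (u + 1))⁻¹ * ∏ m ∈ Finset.Ioc l u, s m * ρ m)) := by
        field_simp
    _ ≤ _ := by gcongr

lemma rhoHat_pos (L : ℕ) (ρ s b : ℕ → ℝ) {l : ℕ} (hl : l < L) (hρ : 0 < ρ l)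
    (hb : 0 < b (l + 1)) : 0 < rhoHat L ρ s b l := by
  have h := prod_le_mul_rhoHat L ρ s b le_rfl hl hρ hb
  simp only [Finset.Ioc_self, Finset.prod_empty, mul_one] at h
  exact pos_of_mul_pos_right (hρ.trans_le h) hb.le

/-- The layerwise covering of a family of networks on finitely many points, valid as long as the
activations stay bounded. -/
lemma exists_layerwise_cover {L : ℕ} {d : ℕ → ℕ} {ι : Type*} [Fintype ι] (σ : Activations d)
    (M : Weights d) {a s ρ b ε : ℕ → ℝ} (hpos : ∀ l < L, 0 < a l ∧ 0 < s l ∧ 0 < ρ l)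
    (hσ : ∀ l < L, ∀ y z, ‖σ l y - σ l z‖ ≤ ρ l * ‖y - z‖) (hb : ∀ l ≤ L, 1 ≤ b l)
    (hε : ∀ l < L, 0 < ε l) (herr : ∀ l ≤ L, netErr s ρ ε l ≤ b l)
    (x : ι → Vec (d 0)) (hx : ∀ i, ‖x i‖ ≤ 3 * b 0) (u : ℕ) (hu : u ≤ L) :
    ∃ U : Finset (Weights d),
      U.card ≤ ∏ l ∈ Finset.range u, ((d (l + 1) + 1) * (2 * Fintype.card ι + 1) ^ 2) ^
        ⌊a l ^ 2 * (3 * b l) ^ 2 / ε l ^ 2⌋₊ ∧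
      ∀ A ∈ paramSpace L M a s, ∃ V ∈ U, ∀ i, ∀ l ≤ u,
        (∀ l', 1 ≤ l' → l' < l → ‖subnet σ A l' (x i)‖ ≤ 2 * b l') →
          ‖subnet σ A l (x i) - subnet σ V l (x i)‖ ≤ netErr s ρ ε l := by
  classical
  induction u with
  | zero =>
    refine ⟨{0}, by simp, fun A _ => ⟨0, by simp, fun i l hl _ => ?_⟩⟩
    obtain rfl : l = 0 := by omega
    simp [subnet, netErr]
  | succ u ih =>
    have huL : u < L := hu
    obtain ⟨U, hcard, hU⟩ := ih huL.le
    obtain ⟨ha, hs, hρ⟩ := hpos u huL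
    have hbu : 0 < b u := one_pos.trans_le (hb u huL.le)
    -- Large activations of V are replaced by 0 so that the matrix covering applies to every V.
    -- Where a guarantee is claimed, the truncation is inactive.
    let pt : Weights d → ι → Vec (d u) := fun V i =>
      if ‖subnet σ V u (x i)‖ ≤ 3 * b u then subnet σ V u (x i) else 0
    have hpt : ∀ V i, ‖pt V i‖ ≤ 3 * b u := by
      intro V i
      simp only [pt]
      split_ifs with h
      · exact h
      · simp; positivity
    choose K hKcard hK using fun V : Weights d =>
      exists_matrix_cover (pt V) ha (by positivity : 0 < 3 * b u) (hε u huL) (hpt V) (M u)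
    refine ⟨U.biUnion fun V => (K V).image fun B => Function.update V u B, ?_, fun A hA => ?_⟩
    · rw [Finset.prod_range_succ]
      refine Finset.card_biUnion_le.trans ((Finset.sum_le_card_nsmul _ _ _ fun V _ =>
        Finset.card_image_le.trans (hKcard V)).trans ?_)
      rw [smul_eq_mul]
      exact Nat.mul_le_mul_right _ hcard
    · obtain ⟨V, hV, hVA⟩ := hU A hA
      obtain ⟨B, hB, hBA⟩ := hK V (A u) (hA u huL).2
      have hsub : ∀ l ≤ u, subnet σ (Function.update V u B) l = subnet σ V l := fun l hl =>
        subnet_congr σ fun l' hl' => Function.update_of_ne (by omega) _ _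
      refine ⟨Function.update V u B, Finset.mem_biUnion.2 ⟨V, hV, Finset.mem_image_of_mem _ hB⟩,
        fun i l hl hbd => ?_⟩
      rcases Nat.lt_or_ge u l with h | h
      · obtain rfl : l = u + 1 := by omega
        have h1 := hVA i u le_rfl fun l' h1 h2 => hbd l' h1 (by omega)
        -- The activation of A is at most 2b and the accumulated error at most b. For u = 0 this is
        -- the assumption on the inputs.
        have hA3 : ‖subnet σ V u (x i)‖ ≤ 3 * b u := by
          rcases Nat.eq_zero_or_pos u with h0 | h0
          · subst h0
            exact hx i
          · have h2 := hbd u h0 (Nat.lt_succ_self u)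
            have h3 := herr u huL.le
            have h4 := norm_sub_norm_le (subnet σ V u (x i)) (subnet σ A u (x i))
            rw [norm_sub_rev] at h4
            linarith
        have hpi : pt V i = subnet σ V u (x i) := by simp only [pt, if_pos hA3]
        have h2 := hBA i
        rw [hpi] at h2
        have h3 : ‖mulVecLin (A u) (subnet σ A u (x i)) - mulVecLin (A u) (subnet σ V u (x i))‖ ≤
            s u * netErr s ρ ε u := by
          rw [← map_sub]
          refine ((mulVecLin (A u)).le_opNorm _).trans ?_
          exact mul_le_mul (hA u huL).1 h1 (norm_nonneg _) hs.le
        simp only [subnet, netErr, hsub u le_rfl, Function.update_self]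
        refine (hσ u huL _ _).trans (mul_le_mul_of_nonneg_left ?_ hρ.le)
        refine (norm_sub_le_norm_sub_add_norm_sub _ (mulVecLin (A u) (subnet σ V u (x i))) _).trans ?_
        linarith
      · rw [hsub l h]
        exact hVA i l h hbd

/-- The covering of a family of networks on finitely many points at the accuracy `ε * b l` for
layer `l`, valid as long as the activations stay bounded. -/
lemma exists_network_cover {L : ℕ} {d : ℕ → ℕ} {ι : Type*} [Fintype ι] (σ : Activations d)
    (M : Weights d) {a s ρ b : ℕ → ℝ} (hpos : ∀ l < L, 0 < a l ∧ 0 < s l ∧ 0 < ρ l)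
    (hσ : ∀ l < L, ∀ y z, ‖σ l y - σ l z‖ ≤ ρ l * ‖y - z‖) (hb : ∀ l ≤ L, 1 ≤ b l)
    {ε : ℝ} (hε : 0 < ε) (hε1 : ε ≤ 1) (x : ι → Vec (d 0)) (hx : ∀ i, ‖x i‖ ≤ 3 * b 0) :
    ∃ U : Finset (Weights d),
      U.card ≤ ((maxWidth L d + 1) * (2 * Fintype.card ι + 1) ^ 2) ^
        ⌊36 * rHat L a ρ s b ^ 2 / ε ^ 2⌋₊ ∧
      ∀ A ∈ paramSpace L M a s, ∃ V ∈ U, ∀ i, ∀ l ≤ L,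
        (∀ l', 1 ≤ l' → l' < l → ‖subnet σ A l' (x i)‖ ≤ 2 * b l') →
          ‖subnet σ A l (x i) - subnet σ V l (x i)‖ ≤ ε * b l := by
  have hbpos : ∀ l ≤ L, 0 < b l := fun l hl => one_pos.trans_le (hb l hl)
  set rh := rhoHat L ρ s b with hrh
  have hrpos : ∀ l < L, 0 < rh l := fun l hl =>
    rhoHat_pos L ρ s b hl (hpos l hl).2.2 (hbpos (l + 1) hl)
  let w : ℕ → ℝ := fun l => (a l * b l * rh l) ^ (2 / 3 : ℝ)
  have hbase : ∀ l < L, 0 < a l * b l * rh l := fun l hl =>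
    mul_pos (mul_pos (hpos l hl).1 (hbpos l hl.le)) (hrpos l hl)
  have hw : ∀ l < L, 0 < w l := fun l hl => Real.rpow_pos_of_pos (hbase l hl) _
  have hw3 : ∀ l < L, w l ^ 3 = (a l * b l * rh l) ^ 2 := by
    intro l hl
    simp only [w]
    rw [← Real.rpow_natCast, ← Real.rpow_mul (hbase l hl).le, ← Real.rpow_natCast]
    norm_num
  set Ws := ∑ l ∈ Finset.range L, w l with hWs
  have hWs0 : 0 ≤ Ws := Finset.sum_nonneg fun l hl => (hw l (Finset.mem_range.1 hl)).le
  have hWspos : ∀ l < L, 0 < Ws := fun l hl => (hw l hl).trans_le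
    (Finset.single_le_sum (f := w) (fun l hl => (hw l (Finset.mem_range.1 hl)).le)
      (Finset.mem_range.2 hl))
  have hR : rHat L a ρ s b ^ 2 = Ws ^ 3 := by
    change (Ws ^ (3 / 2 : ℝ)) ^ 2 = Ws ^ 3
    rw [← Real.rpow_natCast, ← Real.rpow_mul hWs0, ← Real.rpow_natCast]
    norm_num
  -- Lagrange multipliers for minimising ∑ (a b / e)² with ∑ 2 e rh = ε: the optimal e is
  -- proportional to (a²b² / rh)^{1/3} = w / rh.
  let e : ℕ → ℝ := fun l => ε * w l / (2 * rh l * Ws)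
  have he : ∀ l < L, 0 < e l := fun l hl => by
    have := hw l hl
    have := hrpos l hl
    have := hWspos l hl
    positivity
  have herr : ∀ l ≤ L, netErr s ρ e l ≤ ε * b l := by
    intro l hl
    rcases l with _ | u
    · have := hbpos 0 hl
      simp only [netErr]
      positivity
    · rw [netErr_succ_eq_sum]
      have h1 : ∀ l ∈ Finset.range (u + 1),
          2 * e l * (ρ l * ∏ m ∈ Finset.Ioc l u, s m * ρ m) ≤ ε * b (u + 1) / Ws * w l := by
        intro l hl'
        have hlu : l ≤ u := Nat.lt_succ_iff.1 (Finset.mem_range.1 hl')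
        have hlL : l < L := by omega
        have := hrpos l hlL
        have := hWspos l hlL
        calc _ ≤ 2 * e l * (b (u + 1) * rh l) := by
              have := he l hlL
              exact mul_le_mul_of_nonneg_left
                (prod_le_mul_rhoHat L ρ s b hlu hl (hpos l hlL).2.2 (hbpos _ hl)) (by positivity)
          _ = _ := by simp only [e]; field_simp
      refine (Finset.sum_le_sum h1).trans ?_
      rw [← Finset.mul_sum]
      have h2 : ∑ l ∈ Finset.range (u + 1), w l ≤ Ws :=
        Finset.sum_le_sum_of_subset_of_nonneg (Finset.range_subset_range.2 hl)
          fun l hl' _ => (hw l (Finset.mem_range.1 hl')).le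
      have h3 := hWspos u hl
      have h4 := hbpos (u + 1) hl
      calc _ ≤ ε * b (u + 1) / Ws * Ws := by gcongr
        _ = _ := by field_simp
  obtain ⟨U, hcard, hU⟩ := exists_layerwise_cover σ M hpos hσ hb he
    (fun l hl => (herr l hl).trans (mul_le_of_le_one_left (hbpos l hl).le hε1)) x hx L le_rfl
  refine ⟨U, hcard.trans ?_, fun A hA => ?_⟩
  · have hfl : ∀ l < L, a l ^ 2 * (3 * b l) ^ 2 / e l ^ 2 = 36 * Ws ^ 2 / ε ^ 2 * w l := by
      intro l hl
      have := (hw l hl).ne'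
      have := (hrpos l hl).ne'
      have := (hWspos l hl).ne'
      have h3 := hw3 l hl
      simp only [e]
      field_simp
      linear_combination (-36 : ℝ) * h3
    calc _ ≤ ∏ l ∈ Finset.range L, ((maxWidth L d + 1) * (2 * Fintype.card ι + 1) ^ 2) ^
          ⌊a l ^ 2 * (3 * b l) ^ 2 / e l ^ 2⌋₊ := by
          refine Finset.prod_le_prod' fun l hl => Nat.pow_le_pow_left ?_ _
          refine Nat.mul_le_mul_right _ (Nat.succ_le_succ ?_)
          exact Finset.le_sup (f := d) (Finset.mem_Icc.2
            ⟨Nat.succ_le_succ (Nat.zero_le l), Finset.mem_range.1 hl⟩)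
      _ ≤ _ := by
          rw [Finset.prod_pow_eq_pow_sum]
          refine Nat.pow_le_pow_right (by positivity) (Nat.le_floor ?_)
          push_cast
          calc _ ≤ ∑ l ∈ Finset.range L, a l ^ 2 * (3 * b l) ^ 2 / e l ^ 2 :=
                Finset.sum_le_sum fun l _ => Nat.floor_le (by positivity)
            _ = ∑ l ∈ Finset.range L, 36 * Ws ^ 2 / ε ^ 2 * w l :=
                Finset.sum_congr rfl fun l hl => hfl l (Finset.mem_range.1 hl)
            _ = 36 * Ws ^ 3 / ε ^ 2 := by rw [← Finset.mul_sum, ← hWs]; ring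
            _ ≤ _ := by rw [hR]
  · obtain ⟨V, hV, hVA⟩ := hU A hA
    exact ⟨V, hV, fun i l hl hbd => (hVA i l hl hbd).trans (herr l hl)⟩

/-! ### The surrogate loss: comparison, regularity and stability -/

/-- The inputs of a tuple, as a family. -/
def inputPt {d₀ k : ℕ} (X : InputTuple d₀ k) : Option (Option (Fin k)) → Vec d₀
  | none => X.1
  | some none => X.2.1
  | some (some i) => X.2.2 i

lemma inputPt_mem {d₀ k : ℕ} (X : InputTuple d₀ k) (i : Option (Option (Fin k))) :
    inputPt X i ∈ inputs X := by
  rcases i with _ | _ | i <;> simp [inputPt, inputs]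

lemma continuous_inputPt {d₀ k : ℕ} (i : Option (Option (Fin k))) :
    Continuous fun X : InputTuple d₀ k => inputPt X i := by
  rcases i with _ | _ | i <;> simp only [inputPt] <;> fun_prop

/-- The ratios between the norms of the activations of a network on a tuple and their bounds. -/
def ratioVec {d : ℕ → ℕ} {k : ℕ} (L : ℕ) (σ : Activations d) (b : ℕ → ℝ) (A : Weights d)
    (X : InputTuple (d 0) k) : Fin L × Option (Option (Fin k)) → ℝ :=
  fun p => ‖subnet σ A (p.1 + 1) (inputPt X p.2)‖ / b (p.1 + 1)

/-- The ramp vanishing below `1` and equal to `1` above `2`. -/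
def ramp (r : ℝ) : ℝ := max 0 (min 1 (r - 1))

lemma ramp_mem (r : ℝ) : ramp r ∈ Set.Icc (0 : ℝ) 1 :=
  ⟨le_max_left _ _, max_le zero_le_one (min_le_left _ _)⟩

lemma continuous_ramp : Continuous ramp := by unfold ramp; fun_prop

lemma abs_ramp_sub_le (r r' : ℝ) : |ramp r - ramp r'| ≤ |r - r'| := by
  unfold ramp
  refine (abs_max_sub_max_le_max _ _ _ _).trans (max_le (by simp) ?_)
  refine (abs_min_sub_min_le_max _ _ _ _).trans (max_le (by simp) ?_)
  simp

/-- The contrastive loss of a network, raised smoothly to `1` as the activations exceed their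
bounds, and set to `1` on tuples with a large input. -/
def surrogate {d : ℕ → ℕ} {k : ℕ} (L : ℕ) (σ : Activations d) (b : ℕ → ℝ)
    (ℓ : (Fin k → ℝ) → ℝ) (A : Weights d) (X : InputTuple (d 0) k) : ℝ :=
  open Classical in
  if ∃ i, 3 * b 0 < ‖inputPt X i‖ then 1
  else max (tupleLoss ℓ (subnet σ A L) X) (ramp ‖ratioVec L σ b A X‖)

section Surrogate

variable {d : ℕ → ℕ} {k L : ℕ} {σ : Activations d} {b : ℕ → ℝ} {ℓ : (Fin k → ℝ) → ℝ}

lemma surrogate_mem (hℓ : ∀ v, ℓ v ∈ Set.Icc (0 : ℝ) 1) (A : Weights d) (X : InputTuple (d 0) k) :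
    surrogate L σ b ℓ A X ∈ Set.Icc (0 : ℝ) 1 := by
  unfold surrogate
  split_ifs
  · simp
  · exact ⟨le_max_of_le_left (hℓ _).1, max_le (hℓ _).2 (ramp_mem _).2⟩

lemma tupleLoss_le_surrogate (hℓ : ∀ v, ℓ v ∈ Set.Icc (0 : ℝ) 1) (A : Weights d)
    (X : InputTuple (d 0) k) : tupleLoss ℓ (subnet σ A L) X ≤ surrogate L σ b ℓ A X := by
  unfold surrogate
  split_ifs
  · exact (hℓ _).2
  · exact le_max_left _ _

lemma surrogate_eq_tupleLoss (hℓ : ∀ v, ℓ v ∈ Set.Icc (0 : ℝ) 1) (hb : ∀ l ≤ L, 1 ≤ b l)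
    (A : Weights d) (X : InputTuple (d 0) k) (hX : ∀ x ∈ inputs X, ‖x‖ ≤ 3 * b 0)
    (hA : ¬ ∃ l ∈ Set.Icc 1 L, ∃ x ∈ inputs X, b l < ‖subnet σ A l x‖) :
    surrogate L σ b ℓ A X = tupleLoss ℓ (subnet σ A L) X := by
  have h1 : ¬ ∃ i, 3 * b 0 < ‖inputPt X i‖ := by
    rintro ⟨i, hi⟩
    exact absurd (hX _ (inputPt_mem X i)) (not_le.2 hi)
  have h2 : ‖ratioVec L σ b A X‖ ≤ 1 := by
    refine (pi_norm_le_iff_of_nonneg zero_le_one).2 fun p => ?_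
    have hb' : 0 < b (p.1 + 1) := one_pos.trans_le (hb _ p.1.2)
    have h : ‖subnet σ A (p.1 + 1) (inputPt X p.2)‖ ≤ b (p.1 + 1) := by
      by_contra hcon
      exact hA ⟨p.1 + 1, ⟨Nat.succ_le_succ (Nat.zero_le _), p.1.2⟩, _, inputPt_mem X p.2,
        not_le.1 hcon⟩
    rw [Real.norm_eq_abs, ratioVec, abs_of_nonneg (by positivity), div_le_one hb']
    exact h
  have h3 : ramp ‖ratioVec L σ b A X‖ = 0 := by
    unfold ramp
    exact max_eq_left ((min_le_right _ _).trans (by linarith))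
  rw [surrogate, if_neg h1, h3]
  exact max_eq_left (hℓ _).1

lemma continuous_of_lipschitz {E F : Type*} [NormedAddCommGroup E] [NormedAddCommGroup F]
    (f : E → F) (c : ℝ) (h : ∀ y z, ‖f y - f z‖ ≤ c * ‖y - z‖) : Continuous f := by
  refine (LipschitzWith.of_dist_le_mul (K := c.toNNReal) fun y z => ?_).continuous
  rw [dist_eq_norm, dist_eq_norm]
  exact (h y z).trans (mul_le_mul_of_nonneg_right (Real.le_coe_toNNReal c) (norm_nonneg _))

lemma continuous_subnet {ρ : ℕ → ℝ} (hσ : ∀ l < L, ∀ y z, ‖σ l y - σ l z‖ ≤ ρ l * ‖y - z‖)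
    (l : ℕ) (hl : l ≤ L) : Continuous fun p : Weights d × Vec (d 0) => subnet σ p.1 l p.2 := by
  induction l with
  | zero => exact continuous_snd
  | succ l ih =>
    simp only [subnet]
    refine (continuous_of_lipschitz (σ l) (ρ l) (hσ l hl)).comp ?_
    have h1 := ih (Nat.le_of_succ_le hl)
    have h2 : Continuous fun p : Weights d × Vec (d 0) => p.1 l :=
      (continuous_apply l).comp continuous_fst
    have h3 : Continuous fun p : Weights d × Vec (d 0) =>
        (p.1 l).mulVec (WithLp.ofLp (subnet σ p.1 l p.2)) :=
      h2.matrix_mulVec ((PiLp.continuous_ofLp 2 _).comp h1)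
    exact (PiLp.continuous_toLp 2 _).comp h3

lemma continuous_tupleLoss {ρ : ℕ → ℝ} {η : ℝ}
    (hσ : ∀ l < L, ∀ y z, ‖σ l y - σ l z‖ ≤ ρ l * ‖y - z‖)
    (hℓη : ∀ v w, |ℓ v - ℓ w| ≤ η * ‖v - w‖) :
    Continuous fun p : Weights d × InputTuple (d 0) k => tupleLoss ℓ (subnet σ p.1 L) p.2 := by
  have hs := continuous_subnet hσ L le_rfl
  refine (continuous_of_lipschitz ℓ η hℓη).comp (continuous_pi fun i => ?_)
  have h1 : Continuous fun p : Weights d × InputTuple (d 0) k => subnet σ p.1 L p.2.1 :=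
    hs.comp (by fun_prop : Continuous fun p : Weights d × InputTuple (d 0) k => (p.1, p.2.1))
  have h2 : Continuous fun p : Weights d × InputTuple (d 0) k => subnet σ p.1 L p.2.2.1 :=
    hs.comp (by fun_prop : Continuous fun p : Weights d × InputTuple (d 0) k => (p.1, p.2.2.1))
  have h3 : Continuous fun p : Weights d × InputTuple (d 0) k => subnet σ p.1 L (p.2.2.2 i) :=
    hs.comp (by fun_prop : Continuous fun p : Weights d × InputTuple (d 0) k => (p.1, p.2.2.2 i))
  exact h1.inner (h2.sub h3)

lemma continuous_max_ramp {ρ : ℕ → ℝ} {η : ℝ}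
    (hσ : ∀ l < L, ∀ y z, ‖σ l y - σ l z‖ ≤ ρ l * ‖y - z‖)
    (hℓη : ∀ v w, |ℓ v - ℓ w| ≤ η * ‖v - w‖) :
    Continuous fun p : Weights d × InputTuple (d 0) k =>
      max (tupleLoss ℓ (subnet σ p.1 L) p.2) (ramp ‖ratioVec L σ b p.1 p.2‖) := by
  refine (continuous_tupleLoss hσ hℓη).max (continuous_ramp.comp (Continuous.norm ?_))
  refine continuous_pi fun q => ((continuous_subnet hσ (q.1 + 1) q.1.2).comp
    (Continuous.prodMk continuous_fst
      ((continuous_inputPt q.2).comp continuous_snd))).norm.div_const _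

/-- The jump to 1 depends only on the tuple, so it does not spoil continuity in the weights; in the
tuple only measurability is left. -/
lemma continuous_surrogate {ρ : ℕ → ℝ} {η : ℝ}
    (hσ : ∀ l < L, ∀ y z, ‖σ l y - σ l z‖ ≤ ρ l * ‖y - z‖)
    (hℓη : ∀ v w, |ℓ v - ℓ w| ≤ η * ‖v - w‖) (X : InputTuple (d 0) k) :
    Continuous fun A => surrogate L σ b ℓ A X := by
  unfold surrogate
  split_ifs
  · exact continuous_const
  · exact (continuous_max_ramp hσ hℓη).comp (Continuous.prodMk continuous_id continuous_const)

lemma measurable_surrogate {ρ : ℕ → ℝ} {η : ℝ}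
    (hσ : ∀ l < L, ∀ y z, ‖σ l y - σ l z‖ ≤ ρ l * ‖y - z‖)
    (hℓη : ∀ v w, |ℓ v - ℓ w| ≤ η * ‖v - w‖) (A : Weights d) :
    Measurable fun X => surrogate L σ b ℓ A X := by
  unfold surrogate
  refine Measurable.ite ?_ measurable_const
    ((continuous_max_ramp hσ hℓη).comp (Continuous.prodMk continuous_const continuous_id)).measurable
  simp only [Set.ofPred_exists]
  exact MeasurableSet.iUnion fun i =>
    measurableSet_lt measurable_const (continuous_inputPt i).norm.measurable

/-- Stability of the contrastive loss under an approximation of the representations. -/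
lemma abs_tupleLoss_sub_le {d₀ m : ℕ} {η B ε : ℝ} (hη : 0 ≤ η) (hB : 0 ≤ B) (hε : 0 ≤ ε)
    (hε1 : ε ≤ 1) (hℓη : ∀ v w, |ℓ v - ℓ w| ≤ η * ‖v - w‖) (f g : Vec d₀ → Vec m)
    (X : InputTuple d₀ k) (hf : ∀ i, ‖f (inputPt X i)‖ ≤ 2 * B)
    (hfg : ∀ i, ‖f (inputPt X i) - g (inputPt X i)‖ ≤ ε * B) :
    |tupleLoss ℓ f X - tupleLoss ℓ g X| ≤ 10 * η * B ^ 2 * ε := by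
  have hg : ∀ i, ‖g (inputPt X i)‖ ≤ 3 * B := by
    intro i
    have h1 := hf i
    have h2 := hfg i
    have h3 := norm_sub_norm_le (g (inputPt X i)) (f (inputPt X i))
    rw [norm_sub_rev] at h3
    have h4 : ε * B ≤ B := mul_le_of_le_one_left hB hε1
    linarith
  refine (hℓη _ _).trans ?_
  rw [show 10 * η * B ^ 2 * ε = η * (10 * B ^ 2 * ε) by ring]
  refine mul_le_mul_of_nonneg_left ((pi_norm_le_iff_of_nonneg (by positivity)).2 fun i => ?_) hη
  have f1 := hf none
  have f2 := hf (some none)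
  have f3 := hf (some (some i))
  have e1 := hfg none
  have e2 := hfg (some none)
  have e3 := hfg (some (some i))
  have g1 := hg none
  simp only [inputPt] at f1 f2 f3 e1 e2 e3 g1
  rw [Pi.sub_apply, Real.norm_eq_abs]
  -- The two terms contribute εB · 4B and 3B · 2εB, whence the factor 10.
  have hsplit : inner ℝ (f X.1) (f X.2.1 - f (X.2.2 i)) - inner ℝ (g X.1) (g X.2.1 - g (X.2.2 i)) =
      inner ℝ (f X.1 - g X.1) (f X.2.1 - f (X.2.2 i)) +
        inner ℝ (g X.1) ((f X.2.1 - g X.2.1) - (f (X.2.2 i) - g (X.2.2 i))) := by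
    simp only [inner_sub_left, inner_sub_right]
    ring
  rw [hsplit]
  have h1 : |inner ℝ (f X.1 - g X.1) (f X.2.1 - f (X.2.2 i))| ≤ ε * B * (2 * B + 2 * B) :=
    (abs_real_inner_le_norm _ _).trans (mul_le_mul e1 ((norm_sub_le _ _).trans (add_le_add f2 f3))
      (norm_nonneg _) (by positivity))
  have h2 : |inner ℝ (g X.1) ((f X.2.1 - g X.2.1) - (f (X.2.2 i) - g (X.2.2 i)))| ≤
      3 * B * (ε * B + ε * B) :=
    (abs_real_inner_le_norm _ _).trans (mul_le_mul g1 ((norm_sub_le _ _).trans (add_le_add e2 e3))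
      (norm_nonneg _) (by positivity))
  refine (abs_add_le _ _).trans ((add_le_add h1 h2).trans (le_of_eq (by ring)))

/-- Stability of the surrogate loss under a layerwise approximation that is accurate as long as
the activations stay bounded. -/
lemma abs_surrogate_sub_le {η ε : ℝ} (hL : 1 ≤ L) (hη : 1 ≤ η) (hb : ∀ l ≤ L, 1 ≤ b l)
    (hℓ : ∀ v, ℓ v ∈ Set.Icc (0 : ℝ) 1) (hℓη : ∀ v w, |ℓ v - ℓ w| ≤ η * ‖v - w‖)
    (hε : 0 ≤ ε) (hε1 : ε ≤ 1) (A V : Weights d) (X : InputTuple (d 0) k)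
    (hAV : (∀ i, ‖inputPt X i‖ ≤ 3 * b 0) → ∀ i, ∀ l ≤ L,
      (∀ l', 1 ≤ l' → l' < l → ‖subnet σ A l' (inputPt X i)‖ ≤ 2 * b l') →
        ‖subnet σ A l (inputPt X i) - subnet σ V l (inputPt X i)‖ ≤ ε * b l) :
    |surrogate L σ b ℓ A X - surrogate L σ b ℓ V X| ≤ 10 * η * b L ^ 2 * ε := by
  have hbL := hb L le_rfl
  have hbpos : ∀ l ≤ L, 0 < b l := fun l hl => one_pos.trans_le (hb l hl)
  have hεle : ε ≤ 10 * η * b L ^ 2 * ε := by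
    have h1 : 1 ≤ b L ^ 2 := one_le_pow₀ hbL
    have h2 : 1 ≤ 10 * η * b L ^ 2 := by nlinarith
    nlinarith
  by_cases hX : ∃ i, 3 * b 0 < ‖inputPt X i‖
  · rw [surrogate, surrogate, if_pos hX, if_pos hX, sub_self, abs_zero]
    exact hε.trans hεle
  · replace hAV := hAV (by push Not at hX; exact hX)
    by_cases hex : ∃ i, ∃ l, 1 ≤ l ∧ l ≤ L ∧ 2 * b l < ‖subnet σ A l (inputPt X i)‖
    · obtain ⟨i, hi⟩ := hex
      classical
      obtain ⟨h1, h2, h3⟩ := Nat.find_spec hi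
      set l := Nat.find hi with hl
      have hmin : ∀ l', 1 ≤ l' → l' < l → ‖subnet σ A l' (inputPt X i)‖ ≤ 2 * b l' := by
        intro l' h1' h2'
        by_contra hcon
        exact Nat.find_min hi h2' ⟨h1', h2'.le.trans h2, not_le.1 hcon⟩
      have h4 := hAV i l h2 hmin
      have hbl := hbpos l h2
      have hV : 2 - ε ≤ ‖ratioVec L σ b V X‖ := by
        refine le_trans ?_ (norm_le_pi_norm (ratioVec L σ b V X) (⟨l - 1, by omega⟩, i))
        have hl1 : l - 1 + 1 = l := by omega
        have h5 := norm_sub_norm_le (subnet σ A l (inputPt X i)) (subnet σ V l (inputPt X i))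
        refine le_trans ?_ (le_abs_self _)
        simp only [ratioVec]
        rw [hl1, le_div_iff₀ hbl]
        linarith
      have hA : 2 ≤ ‖ratioVec L σ b A X‖ := by
        refine le_trans ?_ (norm_le_pi_norm (ratioVec L σ b A X) (⟨l - 1, by omega⟩, i))
        have hl1 : l - 1 + 1 = l := by omega
        refine le_trans ?_ (le_abs_self _)
        simp only [ratioVec]
        rw [hl1, le_div_iff₀ hbl]
        exact h3.le
      have hA1 : surrogate L σ b ℓ A X = 1 := by
        refine le_antisymm (surrogate_mem hℓ A X).2 ?_
        rw [surrogate, if_neg hX]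
        refine le_max_of_le_right (le_max_of_le_right (le_min le_rfl (by linarith)))
      have hV1 : 1 - ε ≤ surrogate L σ b ℓ V X := by
        rw [surrogate, if_neg hX]
        exact le_max_of_le_right (le_max_of_le_right (le_min (by linarith) (by linarith)))
      have hV2 := (surrogate_mem (L := L) (σ := σ) (b := b) hℓ V X).2
      rw [hA1, abs_of_nonneg (by linarith)]
      linarith
    · push Not at hex
      have hall : ∀ i, ∀ l ≤ L,
          ‖subnet σ A l (inputPt X i) - subnet σ V l (inputPt X i)‖ ≤ ε * b l :=
        fun i l hl => hAV i l hl fun l' h1 h2 => hex i l' h1 (h2.le.trans hl)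
      rw [surrogate, surrogate, if_neg hX, if_neg hX]
      refine (abs_max_sub_max_le_max _ _ _ _).trans (max_le ?_ ?_)
      · exact abs_tupleLoss_sub_le (by linarith) (by linarith) hε hε1 hℓη _ _ X
          (fun i => hex i L hL le_rfl) fun i => hall i L le_rfl
      · refine ((abs_ramp_sub_le _ _).trans (abs_norm_sub_norm_le _ _)).trans (le_trans ?_ hεle)
        refine (pi_norm_le_iff_of_nonneg hε).2 fun p => ?_
        have hbp := hbpos (p.1 + 1) p.1.2
        rw [Pi.sub_apply, Real.norm_eq_abs]
        simp only [ratioVec]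
        rw [← sub_div, abs_div, abs_of_pos hbp, div_le_iff₀ hbp]
        exact (abs_norm_sub_norm_le _ _).trans (hall p.2 (p.1 + 1) p.1.2)

/-- The covering of the surrogate losses on finitely many tuples. -/
lemma exists_surrogate_cover {ι : Type*} [Fintype ι] (M : Weights d) {a s ρ : ℕ → ℝ} {η ε : ℝ}
    (hL : 1 ≤ L) (hpos : ∀ l < L, 0 < a l ∧ 0 < s l ∧ 0 < ρ l)
    (hσ : ∀ l < L, ∀ y z, ‖σ l y - σ l z‖ ≤ ρ l * ‖y - z‖) (hb : ∀ l ≤ L, 1 ≤ b l)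
    (hη : 1 ≤ η) (hℓ : ∀ v, ℓ v ∈ Set.Icc (0 : ℝ) 1) (hℓη : ∀ v w, |ℓ v - ℓ w| ≤ η * ‖v - w‖)
    (hε : 0 < ε) (X : ι → InputTuple (d 0) k) :
    ∃ U : Finset (Weights d),
      U.card ≤ ((maxWidth L d + 1) * (2 * (Fintype.card ι * (k + 2)) + 1) ^ 2) ^
        ⌊36 * rHat L a ρ s b ^ 2 / ε ^ 2⌋₊ ∧
      ∀ A ∈ paramSpace L M a s, ∃ V ∈ U, ∀ j,
        |surrogate L σ b ℓ A (X j) - surrogate L σ b ℓ V (X j)| ≤ 10 * η * b L ^ 2 * ε := by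
  classical
  -- For ε > 1 the claimed accuracy exceeds 1, the diameter of [0,1], and one arbitrary network is
  -- enough.
  rcases le_or_gt ε 1 with hε1 | hε1
  · let x : ι × Option (Option (Fin k)) → Vec (d 0) := fun p =>
      if ‖inputPt (X p.1) p.2‖ ≤ 3 * b 0 then inputPt (X p.1) p.2 else 0
    have hx : ∀ p, ‖x p‖ ≤ 3 * b 0 := by
      intro p
      have := hb 0 (Nat.zero_le L)
      simp only [x]
      split_ifs with h
      · exact h
      · simp; linarith
    obtain ⟨U, hcard, hU⟩ := exists_network_cover σ M hpos hσ hb hε hε1 x hx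
    refine ⟨U, by simpa using hcard, fun A hA => ?_⟩
    obtain ⟨V, hV, hVA⟩ := hU A hA
    refine ⟨V, hV, fun j => abs_surrogate_sub_le hL hη hb hℓ hℓη hε.le hε1 A V (X j)
      fun hX i => ?_⟩
    have hxi : x (j, i) = inputPt (X j) i := if_pos (hX i)
    have := hVA (j, i)
    rwa [hxi] at this
  · refine ⟨{0}, ?_, fun A _ => ⟨0, by simp, fun j => ?_⟩⟩
    · rw [Finset.card_singleton]
      exact Nat.one_le_pow _ _ (by positivity)
    · have h1 := surrogate_mem (L := L) (σ := σ) (b := b) hℓ A (X j)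
      have h2 := surrogate_mem (L := L) (σ := σ) (b := b) hℓ 0 (X j)
      have h3 : |surrogate L σ b ℓ A (X j) - surrogate L σ b ℓ 0 (X j)| ≤ 1 := by
        rw [abs_le]
        constructor <;> linarith [h1.1, h1.2, h2.1, h2.2]
      have h4 : 1 ≤ b L ^ 2 := one_le_pow₀ (hb L le_rfl)
      have h5 : 1 ≤ 10 * η * b L ^ 2 := by nlinarith
      nlinarith

end Surrogate

/-! ### Laws of the tuples and positivity of the complexity -/

lemma isProbabilityMeasure_negDist {𝒞 : Type*} {d₀ : ℕ} (π : PMF 𝒞) (hπ : ∀ c, π c ≠ 1)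
    (D : 𝒞 → Measure (Vec d₀)) (hD : ∀ c, IsProbabilityMeasure (D c)) (c : 𝒞) :
    IsProbabilityMeasure (negDist π D c) := by
  have hle : ∑' z : {z : 𝒞 // z ≠ c}, π z ≤ 1 := by
    rw [← π.tsum_coe]
    exact ENNReal.tsum_comp_le_tsum_of_injective Subtype.val_injective π
  -- A vanishing normaliser would force the support of π to be {c}, hence π c = 1.
  have hne : ∑' z : {z : 𝒞 // z ≠ c}, π z ≠ 0 := by
    intro h0
    rw [ENNReal.tsum_eq_zero] at h0
    refine hπ c ((π.apply_eq_one_iff c).2 (Set.Subset.antisymm (fun z hz => ?_) fun z hz => ?_))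
    · by_contra hzc
      exact (π.mem_support_iff z).1 hz (h0 ⟨z, hzc⟩)
    · obtain rfl : z = c := hz
      obtain ⟨z', hz'⟩ := π.support_nonempty
      by_cases h : z' = z
      · exact h ▸ hz'
      · exact absurd (h0 ⟨z', h⟩) ((π.mem_support_iff z').1 hz')
  constructor
  rw [negDist, Measure.smul_apply, Measure.sum_apply _ MeasurableSet.univ]
  simp only [Measure.smul_apply, measure_univ, smul_eq_mul, mul_one]
  exact ENNReal.inv_mul_cancel hne (ne_top_of_le_ne_top ENNReal.one_ne_top hle)

lemma isProbabilityMeasure_tupleLaw {𝒞 : Type*} {d₀ : ℕ} (k : ℕ) (π : PMF 𝒞)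
    (hπ : ∀ c, π c ≠ 1) (D : 𝒞 → Measure (Vec d₀)) (hD : ∀ c, IsProbabilityMeasure (D c)) :
    IsProbabilityMeasure (tupleLaw k π D) := by
  have := isProbabilityMeasure_negDist π hπ D hD
  constructor
  rw [tupleLaw, Measure.sum_apply _ MeasurableSet.univ]
  simp only [Measure.smul_apply, measure_univ, smul_eq_mul, mul_one]
  exact π.tsum_coe

lemma rHat_pos {L : ℕ} {a s ρ b : ℕ → ℝ} (hL : 1 ≤ L)
    (hpos : ∀ l < L, 0 < a l ∧ 0 < s l ∧ 0 < ρ l) (hb : ∀ l ≤ L, 1 ≤ b l) :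
    0 < rHat L a ρ s b := by
  have hbpos : ∀ l ≤ L, 0 < b l := fun l hl => one_pos.trans_le (hb l hl)
  refine Real.rpow_pos_of_pos (Finset.sum_pos (fun l hl => Real.rpow_pos_of_pos ?_ _) ?_) _
  · have hl' := Finset.mem_range.1 hl
    exact mul_pos (mul_pos (hpos l hl').1 (hbpos l hl'.le))
      (rhoHat_pos L ρ s b hl' (hpos l hl').2.2 (hbpos (l + 1) hl'))
  · exact Finset.nonempty_range_iff.2 (by omega)

/-! ### Rademacher averages of the surrogate class -/

/-- The Rademacher averages of differences of surrogate losses. -/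
lemma cubeMean_surrogate_le {d : ℕ → ℕ} {k L n : ℕ} {σ : Activations d} {b : ℕ → ℝ}
    {ℓ : (Fin k → ℝ) → ℝ} (M : Weights d) {a s ρ : ℕ → ℝ} {η : ℝ}
    (hL : 1 ≤ L) (hn : 1 ≤ n) (hpos : ∀ l < L, 0 < a l ∧ 0 < s l ∧ 0 < ρ l)
    (hσ : ∀ l < L, ∀ y z, ‖σ l y - σ l z‖ ≤ ρ l * ‖y - z‖) (hb : ∀ l ≤ L, 1 ≤ b l)
    (hη : 1 ≤ η) (hℓ : ∀ v, ℓ v ∈ Set.Icc (0 : ℝ) 1) (hℓη : ∀ v w, |ℓ v - ℓ w| ≤ η * ‖v - w‖)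
    {T : Type*} [Finite T] [Nonempty T] (A : T → Weights d) (hA : ∀ t, A t ∈ paramSpace L M a s)
    (ω : Fin n → InputTuple (d 0) k × InputTuple (d 0) k) (J : ℕ) :
    cubeMean (fun τ => ⨆ t, radSum (fun j =>
        surrogate L σ b ℓ (A t) (ω j).2 - surrogate L σ b ℓ (A t) (ω j).1) τ) ≤
      J * (5 * (140 * (η * b L ^ 2 * rHat L a ρ s b)) * Real.sqrt (n * Real.log
        ((maxWidth L d + 1) * (2 * (n * 2 * (k + 2)) + 1) ^ 2))) +
        n * (140 * (η * b L ^ 2 * rHat L a ρ s b) / 2 ^ J) := by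
  classical
  set R := rHat L a ρ s b with hRdef
  have hR : 0 < R := rHat_pos hL hpos hb
  have hbL := hb L le_rfl
  let X : Fin n × Bool → InputTuple (d 0) k := fun p => if p.2 then (ω p.1).2 else (ω p.1).1
  -- The factor 7 makes 36/49 < 1, so the exponent vanishes at scale 0 and the coarsest net is a
  -- single point. The diameter constant is 140 = 2 · 10 · 7, with the 2 coming from differences
  -- over the double sample.
  choose U hUcard hU using fun i : ℕ => exists_surrogate_cover (ℓ := ℓ) (σ := σ) M hL hpos hσ hb hη
    hℓ hℓη (by positivity : 0 < 7 * R / 2 ^ i) X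
  have hfl : ∀ i : ℕ, 36 * R ^ 2 / (7 * R / 2 ^ i) ^ 2 = 36 / 49 * 4 ^ i := by
    intro i
    have h4 : (4 : ℝ) ^ i = (2 ^ i) ^ 2 := by rw [← pow_mul, mul_comm i 2, pow_mul]; norm_num
    rw [h4]
    field_simp
    norm_num
  rw [← hRdef] at hUcard
  simp only [hfl] at hUcard
  refine cubeMean_iSup_radSum_le (by omega) _ (by positivity) ?_
    (fun i => (U i).image fun V j =>
      surrogate L σ b ℓ V (ω j).2 - surrogate L σ b ℓ V (ω j).1) ?_ (fun i => ?_)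
    (fun i t => ?_) J
  · have h1 : (0 : ℝ) ≤ maxWidth L d := Nat.cast_nonneg _
    have h2 : (0 : ℝ) < n * 2 * (k + 2) := by
      have : (0 : ℝ) < n := by exact_mod_cast hn
      positivity
    nlinarith [sq_nonneg (2 * (n * 2 * (k + 2)) : ℝ)]
  · refine Finset.card_image_le.trans ((hUcard 0).trans (le_of_eq ?_))
    have : ⌊(36 / 49 * 4 ^ 0 : ℝ)⌋₊ = 0 := by
      rw [Nat.floor_eq_zero]; norm_num
    rw [this, pow_zero]
  · have h1 : ⌊(36 / 49 * 4 ^ i : ℝ)⌋₊ ≤ 4 ^ i := by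
      refine Nat.floor_le_of_le ?_
      push_cast
      have : (0 : ℝ) < 4 ^ i := by positivity
      linarith
    have h2 : ((U i).image fun V j =>
        surrogate L σ b ℓ V (ω j).2 - surrogate L σ b ℓ V (ω j).1).card ≤
        ((maxWidth L d + 1) * (2 * (n * 2 * (k + 2)) + 1) ^ 2) ^ 4 ^ i := by
      refine Finset.card_image_le.trans ((hUcard i).trans ?_)
      rw [Fintype.card_prod, Fintype.card_fin, Fintype.card_bool]
      exact Nat.pow_le_pow_right (by positivity) h1
    exact_mod_cast h2
  · obtain ⟨V, hV, hVA⟩ := hU i (A t) (hA t)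
    refine ⟨_, Finset.mem_image_of_mem _ hV, fun j => ?_⟩
    have e1 : |surrogate L σ b ℓ (A t) (ω j).2 - surrogate L σ b ℓ V (ω j).2| ≤
      10 * η * b L ^ 2 * (7 * R / 2 ^ i) := hVA (j, true)
    have e2 : |surrogate L σ b ℓ (A t) (ω j).1 - surrogate L σ b ℓ V (ω j).1| ≤
      10 * η * b L ^ 2 * (7 * R / 2 ^ i) := hVA (j, false)
    have h3 : 140 * (η * b L ^ 2 * R) / 2 ^ i = 10 * η * b L ^ 2 * (7 * R / 2 ^ i) +
      10 * η * b L ^ 2 * (7 * R / 2 ^ i) := by ring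
    rw [h3]
    rw [abs_le] at *
    constructor <;> linarith

/-- The numerical form of the chaining bound. -/
lemma chaining_bound_le {K : ℝ} (hK : 0 < K) {n : ℕ} (hn : 1 ≤ n) (k W : ℕ) :
    ((Nat.log 2 n + 1 : ℕ) : ℝ) * (5 * (140 * K) * Real.sqrt (n * Real.log
        ((W + 1) * (2 * (n * 2 * (k + 2)) + 1) ^ 2))) +
        n * (140 * K / 2 ^ (Nat.log 2 n + 1)) ≤
      n * (5460 * (K / Real.sqrt n) * (1 + Real.log W) *
        Real.log ((K * n + 7) * n * (k + 2)) ^ 2) := by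
  have hn1 : (1 : ℝ) ≤ n := by exact_mod_cast hn
  have hk0 : (0 : ℝ) ≤ k := Nat.cast_nonneg k
  set y := (K * n + 7) * n * (k + 2) with hy
  set Y := Real.log y with hY
  set w := Real.log W with hw
  have hnk : (2 : ℝ) ≤ n * (k + 2) := by nlinarith
  have hy7 : 7 * (n * (k + 2)) ≤ y := by
    have : 0 < K * n * (n * (k + 2)) := by positivity
    rw [hy]; nlinarith
  have hy0 : 0 < y := by linarith
  have hY1 : 1 ≤ Y := by
    rw [hY, Real.le_log_iff_exp_le hy0]
    linarith [Real.exp_one_lt_d9]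
  have hw0 : 0 ≤ w := by
    rcases Nat.eq_zero_or_pos W with h | h
    · simp [hw, h]
    · exact Real.log_nonneg (by exact_mod_cast h)
  have hw1 : Real.log (W + 1) ≤ 1 + w := by
    rcases Nat.eq_zero_or_pos W with h | h
    · simp [hw, h]
    · have hW : (1 : ℝ) ≤ W := by exact_mod_cast h
      calc Real.log (W + 1) ≤ Real.log (2 * W) := Real.log_le_log (by linarith) (by linarith)
        _ = Real.log 2 + w := by rw [Real.log_mul (by norm_num) (by linarith)]
        _ ≤ _ := by linarith [Real.log_two_lt_d9]
  set Λ := Real.log ((W + 1) * (2 * (n * 2 * (k + 2)) + 1) ^ 2) with hΛ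
  have hW0 : (0 : ℝ) ≤ W := Nat.cast_nonneg W
  have hΛle : Λ ≤ 3 * ((1 + w) * Y) := by
    have h1 : Λ = Real.log (W + 1) + 2 * Real.log (2 * (n * 2 * (k + 2)) + 1) := by
      rw [hΛ, Real.log_mul (by positivity) (by positivity), Real.log_pow]
      norm_num
    have h2 : Real.log (2 * (n * 2 * (k + 2)) + 1) ≤ Y :=
      Real.log_le_log (by positivity) (by linarith)
    nlinarith [mul_nonneg hw0 (by linarith : 0 ≤ Y - 1)]
  have hΛ1 : 1 ≤ Λ := by
    rw [hΛ, Real.le_log_iff_exp_le (by positivity)]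
    have h1 : (9 : ℝ) ≤ 2 * (n * 2 * (k + 2)) + 1 := by linarith
    have h2 : (81 : ℝ) ≤ (2 * (n * 2 * (k + 2)) + 1) ^ 2 := by nlinarith
    have h3 := Real.exp_one_lt_d9
    nlinarith
  -- A deliberate loss: the root is dropped, which leaves a full factor 1 + log W.
  have hsΛ : Real.sqrt Λ ≤ Λ := by
    rw [Real.sqrt_le_left (by linarith)]
    nlinarith
  have hJ : ((Nat.log 2 n + 1 : ℕ) : ℝ) ≤ 5 / 2 * Y := by
    have h1 : ((2 : ℝ)) ^ Nat.log 2 n ≤ n := by exact_mod_cast Nat.pow_log_le_self 2 (by omega)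
    have h2 := Real.log_le_log (by positivity) h1
    rw [Real.log_pow] at h2
    have h3 : Real.log n ≤ Y := Real.log_le_log (by linarith) (by nlinarith)
    have h4 := Real.log_two_gt_d9
    have h5 : (0 : ℝ) ≤ Nat.log 2 n := Nat.cast_nonneg _
    push_cast
    nlinarith
  -- With this many scales the unresolved remainder n · 140K / 2^J is at most 140K.
  have hpow : (n : ℝ) ≤ 2 ^ (Nat.log 2 n + 1) := by
    exact_mod_cast (Nat.lt_pow_succ_log_self (by norm_num) n).le
  have hsn : 1 ≤ Real.sqrt n := Real.one_le_sqrt.2 hn1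
  have hnn : (n : ℝ) * (K / Real.sqrt n) = K * Real.sqrt n := by
    have := Real.sq_sqrt (by linarith : (0 : ℝ) ≤ n)
    field_simp
    linarith
  have hP : 1 ≤ (1 + w) * Y ^ 2 := by
    have : 1 ≤ Y ^ 2 := one_le_pow₀ hY1
    nlinarith
  calc _ ≤ 5 / 2 * Y * (5 * (140 * K) * (Real.sqrt n * (3 * ((1 + w) * Y)))) + 140 * K := by
        rw [Real.sqrt_mul (by linarith)]
        refine add_le_add ?_ ?_
        · gcongr
          exact hsΛ.trans hΛle
        · rw [mul_div_assoc', div_le_iff₀ (by positivity), mul_comm]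
          gcongr
    _ ≤ 5 / 2 * Y * (5 * (140 * K) * (Real.sqrt n * (3 * ((1 + w) * Y)))) +
          140 * K * (Real.sqrt n * ((1 + w) * Y ^ 2)) := by
        have : 1 ≤ Real.sqrt n * ((1 + w) * Y ^ 2) := by nlinarith
        have : 140 * K * 1 ≤ 140 * K * (Real.sqrt n * ((1 + w) * Y ^ 2)) := by gcongr
        linarith
    -- The constants add up to 5/2 · 5 · 140 · 3 + 140 = 5390.
    _ ≤ 5460 * (K * Real.sqrt n) * (1 + w) * Y ^ 2 := by
        have : 0 ≤ K * Real.sqrt n * ((1 + w) * Y ^ 2) := by positivity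
        nlinarith
    _ = _ := by rw [← hnn]; ring

/-! ### Continuity of the deviation in the weights, and comparison of the risks -/

lemma continuous_sum_deviation {d : ℕ → ℕ} {k L n : ℕ} {σ : Activations d} {b : ℕ → ℝ}
    {ℓ : (Fin k → ℝ) → ℝ} {ρ : ℕ → ℝ} {η : ℝ}
    (hσ : ∀ l < L, ∀ y z, ‖σ l y - σ l z‖ ≤ ρ l * ‖y - z‖)
    (hℓ : ∀ v, ℓ v ∈ Set.Icc (0 : ℝ) 1) (hℓη : ∀ v w, |ℓ v - ℓ w| ≤ η * ‖v - w‖)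
    (P : Measure (InputTuple (d 0) k)) [IsProbabilityMeasure P]
    (S : Fin n → InputTuple (d 0) k) :
    Continuous fun A : Weights d =>
      ∑ j, ((∫ X, surrogate L σ b ℓ A X ∂P) - surrogate L σ b ℓ A (S j)) := by
  have : SecondCountableTopology (Weights d) :=
    inferInstanceAs (SecondCountableTopology ((l : ℕ) → Fin (d (l + 1)) → Fin (d l) → ℝ))
  refine continuous_finsetSum _ fun j _ => Continuous.sub ?_ (continuous_surrogate hσ hℓη (S j))
  refine continuous_of_dominated (bound := fun _ => (1 : ℝ))
    (fun A => (measurable_surrogate hσ hℓη A).aestronglyMeasurable)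
    (fun A => Filter.Eventually.of_forall fun X => ?_) (integrable_const _)
    (Filter.Eventually.of_forall fun X => continuous_surrogate hσ hℓη X)
  rw [Real.norm_eq_abs, abs_of_nonneg (surrogate_mem hℓ A X).1]
  exact (surrogate_mem hℓ A X).2

lemma popRisk_le_integral_surrogate {𝒞 : Type*} {d : ℕ → ℕ} {k L : ℕ} {σ : Activations d}
    {b : ℕ → ℝ} {ℓ : (Fin k → ℝ) → ℝ} {ρ : ℕ → ℝ} {η : ℝ} (π : PMF 𝒞)
    (D : 𝒞 → Measure (Vec (d 0))) [IsProbabilityMeasure (tupleLaw k π D)]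
    (hσ : ∀ l < L, ∀ y z, ‖σ l y - σ l z‖ ≤ ρ l * ‖y - z‖)
    (hℓ : ∀ v, ℓ v ∈ Set.Icc (0 : ℝ) 1) (hℓη : ∀ v w, |ℓ v - ℓ w| ≤ η * ‖v - w‖)
    (A : Weights d) :
    popRisk π D ℓ (subnet σ A L) ≤ ∫ X, surrogate L σ b ℓ A X ∂(tupleLaw k π D) := by
  refine integral_mono_of_nonneg (Filter.Eventually.of_forall fun X => (hℓ _).1) ?_
    (Filter.Eventually.of_forall fun X => tupleLoss_le_surrogate hℓ A X)
  refine Integrable.of_bound (measurable_surrogate hσ hℓη A).aestronglyMeasurable 1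
    (Filter.Eventually.of_forall fun X => ?_)
  rw [Real.norm_eq_abs, abs_of_nonneg (surrogate_mem hℓ A X).1]
  exact (surrogate_mem hℓ A X).2

/-- On a sample with bounded inputs, the surrogate loss exceeds the contrastive loss on at most
`numExceed` tuples. -/
lemma sum_surrogate_le {d : ℕ → ℕ} {k L n : ℕ} {σ : Activations d} {b : ℕ → ℝ}
    {ℓ : (Fin k → ℝ) → ℝ} (hℓ : ∀ v, ℓ v ∈ Set.Icc (0 : ℝ) 1) (hb : ∀ l ≤ L, 1 ≤ b l)
    (A : Weights d) (S : Fin n → InputTuple (d 0) k)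
    (hS : ∀ j, ∀ x ∈ inputs (S j), ‖x‖ ≤ 3 * b 0) :
    ∑ j, surrogate L σ b ℓ A (S j) ≤
      ∑ j, tupleLoss ℓ (subnet σ A L) (S j) + numExceed L σ A b S := by
  classical
  let bad : Fin n → Prop := fun j =>
    ∃ l ∈ Set.Icc 1 L, ∃ x ∈ inputs (S j), b l < ‖subnet σ A l x‖
  have hcount : (numExceed L σ A b S : ℝ) = ∑ j, if bad j then (1 : ℝ) else 0 := by
    rw [Finset.sum_boole, numExceed, Set.ncard_eq_toFinset_card']
    congr 2
    ext j
    simp [bad]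
  rw [hcount, ← Finset.sum_add_distrib]
  refine Finset.sum_le_sum fun j _ => ?_
  by_cases hj : bad j
  · rw [if_pos hj]
    have h1 := (surrogate_mem (L := L) (σ := σ) (b := b) hℓ A (S j)).2
    have h2 : 0 ≤ tupleLoss ℓ (subnet σ A L) (S j) := (hℓ _).1
    linarith
  · rw [if_neg hj, add_zero]
    exact (surrogate_eq_tupleLoss hℓ hb A (S j) (hS j) hj).le

end

end ContrastiveNet

/-! ### The generalization bound -/

theorem theorem3 :
    ∃ (C : ℝ) (p : ℕ), 0 < C ∧
      ∀ (L n k : ℕ) (d : ℕ → ℕ) (_ : 1 ≤ L) (_ : 1 ≤ n)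
        -- the classes, their probabilities, and the class-conditional distributions
        (𝒞 : Type*) (π : PMF 𝒞) (_ : ∀ c, π c ≠ 1)
        (D : 𝒞 → MeasureTheory.Measure (Vec (d 0)))
        (_ : ∀ c, MeasureTheory.IsProbabilityMeasure (D c))
        -- the networks
        (σ : Activations d) (M : Weights d) (a s ρ b : ℕ → ℝ)
        (_ : ∀ l < L, 0 < a l ∧ 0 < s l ∧ 0 < ρ l)
        (_ : ∀ l < L, ∀ y z, ‖σ l y - σ l z‖ ≤ ρ l * ‖y - z‖)
        (_ : ∀ l ≤ L, 1 ≤ b l)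
        -- the loss; the norm on `Fin k → ℝ` is the supremum norm
        (ℓ : (Fin k → ℝ) → ℝ) (η : ℝ) (_ : 1 ≤ η)
        (_ : ∀ v, ℓ v ∈ Set.Icc (0 : ℝ) 1)
        (_ : ∀ v w, |ℓ v - ℓ w| ≤ η * ‖v - w‖)
        (δ : ℝ) (_ : δ ∈ Set.Ioo (0 : ℝ) 1),
        -- the probability of failure is at most `δ`
        sampleLaw n k π D
          {S | ¬ ((∀ j, ∀ x ∈ inputs (S j), ‖x‖ ≤ 3 * b 0) →
            ∀ A ∈ paramSpace L M a s,
              popRisk π D ℓ (subnet σ A L) - empRisk ℓ (subnet σ A L) S ≤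
                C * (η * b L ^ 2 * rHat L a ρ s b / Real.sqrt n) *
                    (1 + Real.log (maxWidth L d)) *
                    Real.log ((η * b L ^ 2 * rHat L a ρ s b * n + 7) * n * (k + 2)) ^ p +
                  (numExceed L σ A b S : ℝ) / n +
                  3 * Real.sqrt (Real.log (2 / δ) / (2 * n)))}
          ≤ ENNReal.ofReal δ := by
  refine ⟨5460, 2, by norm_num, ?_⟩
  intro L n k d hL hn 𝒞 π hπ D hD σ M a s ρ b hpos hσ hb ℓ η hη hℓ hℓη δ hδ
  have hP := isProbabilityMeasure_tupleLaw k π hπ D hD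
  set P := tupleLaw k π D with hPdef
  have hn0 : (0 : ℝ) < n := by exact_mod_cast hn
  have hbL := hb L le_rfl
  set K := η * b L ^ 2 * rHat L a ρ s b with hK
  have hKpos : 0 < K := by
    have := rHat_pos hL hpos hb
    positivity
  -- With no admissible parameter the failure event is empty; otherwise a dense sequence exists.
  rcases (paramSpace L M a s).eq_empty_or_nonempty with hemp | hne
  · refine le_of_eq_of_le ?_ zero_le
    convert measure_empty (μ := sampleLaw n k π D)
    simp [hemp]
  have : SecondCountableTopology (Weights d) :=
    inferInstanceAs (SecondCountableTopology ((l : ℕ) → Fin (d (l + 1)) → Fin (d l) → ℝ))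
  have : Nonempty (paramSpace L M a s) := hne.to_subtype
  let A : ℕ → Weights d := fun t => (TopologicalSpace.denseSeq (paramSpace L M a s) t : Weights d)
  have hA : ∀ t, A t ∈ paramSpace L M a s := fun t => Subtype.coe_prop _
  set w := Real.log (maxWidth L d) with hw
  set Y := Real.log ((K * n + 7) * n * (k + 2)) with hY
  set β := n * (5460 * (K / Real.sqrt n) * (1 + w) * Y ^ 2) with hβ
  set u := 3 * Real.sqrt (Real.log (2 / δ) / (2 * n)) with hu
  have hmain := measure_deviation_seq_le P (n := n) (fun t => surrogate L σ b ℓ (A t))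
    (fun t => measurable_surrogate hσ hℓη (A t)) (fun t => surrogate_mem hℓ (A t)) β
    (fun N ω => (cubeMean_surrogate_le M hL hn hpos hσ hb hη hℓ hℓη
      (fun t : Fin (N + 1) => A t) (fun t => hA t) ω (Nat.log 2 n + 1)).trans
        (chaining_bound_le hKpos hn k (maxWidth L d))) u (by positivity)
  -- The exponent is (9/4) log(2/δ), which is more than log(1/δ).
  have hexp : Real.exp (-(n * u ^ 2 / 2)) ≤ δ := by
    have h2 : 0 ≤ Real.log (2 / δ) :=
      Real.log_nonneg (by rw [le_div_iff₀ hδ.1]; linarith [hδ.2])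
    have h3 : n * u ^ 2 / 2 = 9 / 4 * Real.log (2 / δ) := by
      rw [hu, mul_pow, Real.sq_sqrt (by positivity)]
      field_simp
      ring
    have h4 : Real.log (2 / δ) = Real.log 2 - Real.log δ :=
      Real.log_div two_ne_zero hδ.1.ne'
    calc _ ≤ Real.exp (Real.log δ) := by
          refine Real.exp_le_exp.2 ?_
          rw [h3]
          linarith [Real.log_pos one_lt_two]
      _ = δ := Real.exp_log hδ.1
  -- Monotonicity holds for outer measures, so the failure event need not be shown measurable.
  refine le_trans (measure_mono ?_) (hmain.trans (ENNReal.ofReal_le_ofReal hexp))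
  intro S hS
  rw [Set.mem_ofPred_eq] at hS
  push Not at hS
  obtain ⟨hin, B, hB, hlt⟩ := hS
  have hcont := (continuous_sum_deviation (b := b) hσ hℓ hℓη P S).comp
    (continuous_subtype_val (p := fun A => A ∈ paramSpace L M a s))
  have hBdev : β + n * u <
      ∑ j, ((∫ X, surrogate L σ b ℓ B X ∂P) - surrogate L σ b ℓ B (S j)) := by
    have h1 := popRisk_le_integral_surrogate (b := b) π D hσ hℓ hℓη B
    have h2 := sum_surrogate_le (σ := σ) hℓ hb B S hin
    rw [Finset.sum_sub_distrib, Finset.sum_const, Finset.card_univ, Fintype.card_fin, nsmul_eq_mul]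
    have h3 := mul_lt_mul_of_pos_left hlt hn0
    have h4 : n * (popRisk π D ℓ (subnet σ B L) - empRisk ℓ (subnet σ B L) S) =
        n * popRisk π D ℓ (subnet σ B L) - ∑ j, tupleLoss ℓ (subnet σ B L) (S j) := by
      rw [empRisk]
      field_simp
    have h5 : n * (5460 * (K / Real.sqrt n) * (1 + w) * Y ^ 2 + (numExceed L σ B b S : ℝ) / n + u) =
        β + numExceed L σ B b S + n * u := by
      rw [hβ]
      field_simp
    rw [h4, h5] at h3
    have h6 := mul_le_mul_of_nonneg_left h1 hn0.le
    linarith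
  -- The violation at B is strict, hence persists on a neighbourhood of B, which contains a member
  -- of the dense sequence.
  obtain ⟨t, ht⟩ := (TopologicalSpace.denseRange_denseSeq
    (paramSpace L M a s)).exists_mem_open (isOpen_lt continuous_const hcont) ⟨⟨B, hB⟩, hBdev⟩
  exact ⟨t, le_of_lt ht⟩
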